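/- In a graph $A=(V,\mathcal E)$, a minimum vertex cover is a vertex cover of smallest cardinality, and a maximum matching is a set of pairwise non-adjacent edges of largest cardinality. For a finite tree $A$, call a vertex brown if it belongs to every minimum vertex cover of $A$. Call a vertex degenerate if it belongs to at least one but not to every minimum vertex cover; call an edge red if both of its ends are degenerate and no minimum vertex cover contains both of them, and call a vertex red if it is an end of a red edge. Let $N_B(A)$ and $N_R(A)$ be the numbers of brown and of red vertices of $A$, and for $n\ge 1$ let $N_B(n)$ and $N_R(n)$ be the sums of $N_B(A)$ and of $N_R(A)$ over all labeled trees $A$ on $n$ vertices. (a) For every finite tree $A$, every minimum vertex cover of $A$ has exactly $N_B(A)+N_R(A)/2$ vertices, and every maximum matching of $A$ has exactly $N_B(A)+N_R(A)/2$ edges. (b) For every $n\ge 1$, the average, over the uniformly random labeled tree on $n$ vertices, of the fraction of vertices contained in a minimum vertex cover equals $n^{1-n}\left(N_B(n)+N_R(n)/2\right)$. (c) As $n\to\infty$ this average tends to $1-\omega=0.4328567095\ldots$, where $\omega$ is the real number with $\omega e^{\omega}=1$. -/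

import Mathlib

open Filter Topology

noncomputable section

namespace TreeColoring

/-- `C` is a minimum vertex cover of `A`: a vertex cover of smallest cardinality. -/
def IsMinVertexCover {V : Type*} (A : SimpleGraph V) (C : Set V) : Prop :=
  A.IsVertexCover C ∧ ∀ D : Set V, A.IsVertexCover D → C.encard ≤ D.encard

/-- `M` is a maximum matching of `A`: a matching with the largest number of edges. -/
def IsMaxMatching {V : Type*} (A : SimpleGraph V) (M : A.Subgraph) : Prop :=
  M.IsMatching ∧ ∀ N : A.Subgraph, N.IsMatching → N.edgeSet.encard ≤ M.edgeSet.encard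

/-- The positive vertex-backbone: the vertices that belong to every minimum vertex cover. -/
def positiveBackbone {V : Type*} (A : SimpleGraph V) : Set V :=
  {v | ∀ C : Set V, IsMinVertexCover A C → v ∈ C}

/-- The negative vertex-backbone: the vertices that belong to no minimum vertex cover. -/
def negativeBackbone {V : Type*} (A : SimpleGraph V) : Set V :=
  {v | ∀ C : Set V, IsMinVertexCover A C → v ∉ C}

/-- A vertex is degenerate if it lies in neither of the two vertex-backbones. -/
def IsDegenerate {V : Type*} (A : SimpleGraph V) (v : V) : Prop :=
  v ∉ positiveBackbone A ∧ v ∉ negativeBackbone A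

/-- `uv` is an exclusive edge: an edge between degenerate vertices such that no minimum vertex
cover contains both of its ends. -/
def IsExclusive {V : Type*} (A : SimpleGraph V) (u v : V) : Prop :=
  A.Adj u v ∧ IsDegenerate A u ∧ IsDegenerate A v ∧
    ∀ C : Set V, IsMinVertexCover A C → ¬ (u ∈ C ∧ v ∈ C)

/-- The brown vertices of the b-coloring: the positive vertex-backbone. -/
def brown {V : Type*} (A : SimpleGraph V) : Set V := positiveBackbone A

/-- The red vertices of the b-coloring: the end-vertices of the red (that is, exclusive) edges. -/
def red {V : Type*} (A : SimpleGraph V) : Set V := {v | ∃ w, IsExclusive A v w}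

/-- `N_B(A)`, the number of brown vertices of a finite tree `A`. -/
def numBrown {V : Type*} (A : SimpleGraph V) : ℕ := (brown A).ncard

/-- `N_R(A)`, the number of red vertices of a finite tree `A`. -/
def numRed {V : Type*} (A : SimpleGraph V) : ℕ := (red A).ncard

open Classical in
/-- The labeled trees on `n` vertices. -/
def labeledTrees (n : ℕ) : Finset (SimpleGraph (Fin n)) :=
  Finset.univ.filter fun A => A.IsTree

/-- `N_B(n)`, the total number of brown vertices among the labeled trees on `n` vertices. -/
def totalBrown (n : ℕ) : ℕ := ∑ A ∈ labeledTrees n, numBrown A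

/-- `N_R(n)`, the total number of red vertices among the labeled trees on `n` vertices. -/
def totalRed (n : ℕ) : ℕ := ∑ A ∈ labeledTrees n, numRed A

/-- The average, over the uniformly random labeled tree `A` on `n` vertices, of the fraction of the
vertices that a minimum vertex cover of `A` contains. -/
def avgCoverFraction (n : ℕ) : ℝ :=
  (∑ A ∈ labeledTrees n, (A.vertexCoverNum.toNat : ℝ) / (n : ℝ)) / ((labeledTrees n).card : ℝ)

end TreeColoring

end

/-! Part (a) is König's theorem made rigid. In a bipartite graph, Hall's condition holds for a
minimum cover `C` against its complement, so `C` is matched by an injection `f` into vertices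
outside it. Counting then shows that every minimum cover consists of one end of each edge `x — f x`
and nothing else (`matched_of_isMinVertexCover`). If `x` is not brown, `x` and `f x` are therefore
both red, and these pairs exhaust the red vertices, so `|C|` is brown plus half of red.

For (b) and (c), a tree with root `p` and a second marked vertex `w ≠ p` is cut at the first edge of
the path from `p` to `w`. This is a bijection onto pairs of rooted trees with `w` marked in one of
them, so every weight on rooted trees that splits along such an edge satisfies a binomial recursion
(`rootedSeq_recursion`). It is applied to the constant 1 (whence Cayley's formula, by Abel's
identity, and then (b)), to the indicator that the root lies in no minimum cover, and to the cover
number.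

In generating functions, with `θ = x d/dx` and `T = T1 + T0` split by whether the root is covered,
these read `θT = T + θT·T`, `θT0 = T0 + θT1·T0`, and an equation for the cover number series `V`,
solved by `V = T1·(1 + θT)`, where `1 + θT = ∑ nⁿ xⁿ/n!`. So the average is a sum of covered counts
against weights tending to `e⁻ᵏ/k!`. The weights have total mass one against `cayley`, before and
after the limit, so no mass escapes and the limit is `T1(1/e) = 1 - T0(1/e)`. Finally `T0 = x exp
T1` at `x = 1/e` gives `ω = exp(-ω)` for `ω = T0(1/e)`. -/

namespace TreeColoring

open SimpleGraph

/-- The vertex cover number as a natural number. -/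
noncomputable def tau {V : Type*} (A : SimpleGraph V) : ℕ := A.vertexCoverNum.toNat

theorem exists_cover_ncard_eq_tau {V : Type*} (A : SimpleGraph V) :
    ∃ C : Set V, A.IsVertexCover C ∧ C.ncard = tau A := by
  obtain ⟨C, hC, hc⟩ := vertexCoverNum_exists A
  exact ⟨C, hc, by rw [tau, ← hC]; rfl⟩

/-! ### Minimum covers and Hall's condition. -/

section Covers

variable {V : Type*} [Finite V] {A : SimpleGraph V} {C D : Set V}

theorem tau_le (hD : A.IsVertexCover D) : tau A ≤ D.ncard := by
  have h := hD.vertexCoverNum_le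
  rw [← (Set.toFinite D).cast_ncard_eq] at h
  exact ENat.toNat_le_of_le_natCast h

theorem isMinVertexCover_iff :
    IsMinVertexCover A C ↔ A.IsVertexCover C ∧ C.ncard = tau A := by
  constructor
  · rintro ⟨h1, h2⟩
    refine ⟨h1, le_antisymm ?_ (tau_le h1)⟩
    obtain ⟨D, hD, hd⟩ := exists_cover_ncard_eq_tau A
    have := h2 D hD
    rw [← (Set.toFinite D).cast_ncard_eq, ← (Set.toFinite C).cast_ncard_eq, hd] at this
    exact_mod_cast this
  · rintro ⟨h1, h2⟩
    refine ⟨h1, fun D hD => ?_⟩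
    rw [← (Set.toFinite D).cast_ncard_eq, ← (Set.toFinite C).cast_ncard_eq, h2]
    exact_mod_cast tau_le hD

theorem exists_isMinVertexCover (A : SimpleGraph V) : ∃ C, IsMinVertexCover A C := by
  obtain ⟨C, hC⟩ := exists_cover_ncard_eq_tau A
  exact ⟨C, isMinVertexCover_iff.2 hC⟩

/-- Exchange argument: replacing `S` by its neighbours outside `C` leaves a cover, since
independence of `S` means no edge has both ends removed. Minimality of `C` gives the inequality. -/
theorem ncard_le_ncard_neighbors_of_isMinVertexCover (hC : IsMinVertexCover A C) {S : Set V}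
    (hSC : S ⊆ C) (hS : ∀ ⦃x y⦄, x ∈ S → y ∈ S → ¬ A.Adj x y) :
    S.ncard ≤ {b | b ∉ C ∧ ∃ a ∈ S, A.Adj a b}.ncard := by
  obtain ⟨hcov, hcard⟩ := isMinVertexCover_iff.1 hC
  set N := {b | b ∉ C ∧ ∃ a ∈ S, A.Adj a b} with hN
  have hD : A.IsVertexCover ((C \ S) ∪ N) := by
    have key : ∀ v w, A.Adj v w → v ∈ S → w ∈ (C \ S) ∪ N := by
      intro v w h hv
      by_cases hw : w ∈ C
      · exact Or.inl ⟨hw, fun h' => hS hv h' h⟩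
      · exact Or.inr ⟨hw, v, hv, h⟩
    intro v w h
    by_cases hv : v ∈ S
    · exact Or.inr (key v w h hv)
    by_cases hw : w ∈ S
    · exact Or.inl (key w v h.symm hw)
    · exact (hcov h).imp (fun h => Or.inl ⟨h, hv⟩) (fun h => Or.inl ⟨h, hw⟩)
  have h1 := tau_le hD
  have h2 := Set.ncard_union_le (C \ S) N
  have h3 := Set.ncard_sdiff_add_ncard_of_subset hSC
  omega

/-- Hall's theorem. A subset of `C` is cut into its two colour classes, each independent; their
outside neighbours lie in opposite classes, so the two exchange inequalities add up. -/
theorem exists_injective_of_isMinVertexCover (hA : A.IsBipartite) (hC : IsMinVertexCover A C) :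
    ∃ f : C → V, Function.Injective f ∧ ∀ x : C, A.Adj x (f x) ∧ f x ∉ C := by
  classical
  have := Fintype.ofFinite V
  obtain ⟨s, t, hst⟩ := isBipartite_iff_exists_isBipartiteWith.1 hA
  refine (Fintype.all_card_le_filter_rel_iff_exists_injective
    (fun (x : C) (b : V) => A.Adj x b ∧ b ∉ C)).1 fun S => ?_
  set S' : Set V := Subtype.val '' (S : Set C) with hS'
  have hS'C : S' ⊆ C := by rintro _ ⟨x, -, rfl⟩; exact x.2
  have hcardS : S.card = S'.ncard := by
    rw [hS', Set.ncard_image_of_injective _ Subtype.val_injective, Set.ncard_coe_finset]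
  have hadj : ∀ ⦃x y⦄, A.Adj x y → (x ∈ s ↔ y ∉ s) := by
    intro x y h
    have hd := Set.disjoint_left.1 hst.disjoint
    rcases hst.mem_of_adj h with ⟨h1, h2⟩ | ⟨h1, h2⟩
    · exact ⟨fun _ h' => hd h' h2, fun _ => h1⟩
    · exact ⟨fun h' => (hd h' h1).elim, fun h' => (h' h2).elim⟩
  have h1 := ncard_le_ncard_neighbors_of_isMinVertexCover hC (S := S' ∩ s)
    (Set.inter_subset_left.trans hS'C) fun x y hx hy h => (hadj h).1 hx.2 hy.2
  have h2 := ncard_le_ncard_neighbors_of_isMinVertexCover hC (S := S' \ s)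
    (Set.sdiff_subset.trans hS'C) fun x y hx hy h => hx.2 ((hadj h).2 hy.2)
  have h3 : (S' ∩ s).ncard + (S' \ s).ncard = S'.ncard := Set.ncard_inter_add_ncard_sdiff_eq_ncard _ _
  rw [hcardS, ← h3]
  refine (add_le_add h1 h2).trans ?_
  rw [← Set.ncard_union_eq, ← Set.ncard_coe_finset]
  · refine Set.ncard_le_ncard ?_
    rintro b (⟨hb, a, ⟨⟨a, ha, rfl⟩, -⟩, hab⟩ | ⟨hb, a, ⟨⟨a, ha, rfl⟩, -⟩, hab⟩)
    all_goals
      simp only [Finset.coe_filter, Finset.mem_univ, true_and, Set.mem_ofPred_eq]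
      exact ⟨a, ha, hab, hb⟩
  · rw [Set.disjoint_left]
    rintro b ⟨hb, a, ha, hab⟩ ⟨-, a', ha', hab'⟩
    exact ha'.2 ((hadj hab').2 ((hadj hab).1 ha.2))

end Covers

/-! ### König's theorem and the count of brown and red vertices. -/

section Konig

variable {V : Type*} [Finite V] {A : SimpleGraph V} {C D : Set V}

theorem ncard_edgeSet_le_of_isVertexCover (hC : A.IsVertexCover C) {M : A.Subgraph}
    (hM : M.IsMatching) : M.edgeSet.ncard ≤ C.ncard := by
  have h : ∀ e : M.edgeSet, ∃ v : C, (v : V) ∈ (e : Sym2 V) := by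
    rintro ⟨e, he⟩
    induction e with
    | _ x y =>
      rcases hC (M.adj_sub he) with h | h
      · exact ⟨⟨x, h⟩, by simp⟩
      · exact ⟨⟨y, h⟩, by simp⟩
  choose g hg using h
  rw [← Nat.card_coe_set_eq, ← Nat.card_coe_set_eq]
  refine Nat.card_le_card_of_injective g ?_
  rintro ⟨e, he⟩ ⟨e', he'⟩ hee
  have h1 := hg ⟨e, he⟩
  have h2 := hg ⟨e', he'⟩
  rw [← hee] at h2
  simp only at h1 h2
  generalize (g ⟨e, he⟩ : V) = v at h1 h2
  obtain ⟨y, rfl⟩ := h1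
  obtain ⟨y', rfl⟩ := h2
  have := hM.eq_of_adj_left (Subgraph.mem_edgeSet.1 he) (Subgraph.mem_edgeSet.1 he')
  simp [this]

/-- The matching formed by the edges `x — f x`. -/
def matchingOfInjective (f : C → V) (hf : ∀ x : C, A.Adj x (f x)) : A.Subgraph where
  verts := C ∪ Set.range f
  Adj x y := (∃ c : C, (c : V) = x ∧ f c = y) ∨ ∃ c : C, (c : V) = y ∧ f c = x
  adj_sub := by
    rintro _ _ (⟨c, rfl, rfl⟩ | ⟨c, rfl, rfl⟩)
    exacts [hf c, (hf c).symm]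
  edge_vert := by
    rintro _ _ (⟨c, rfl, rfl⟩ | ⟨c, rfl, rfl⟩)
    exacts [Or.inl c.2, Or.inr ⟨c, rfl⟩]
  symm := ⟨fun _ _ h => h.symm⟩

theorem exists_isMatching_ncard_edgeSet (f : C → V) (hinj : Function.Injective f)
    (hf : ∀ x : C, A.Adj x (f x) ∧ f x ∉ C) :
    ∃ M : A.Subgraph, M.IsMatching ∧ M.edgeSet.ncard = C.ncard := by
  have hm : (matchingOfInjective f fun x => (hf x).1).IsMatching := by
    rintro v (hv | ⟨c, rfl⟩)
    · refine ⟨f ⟨v, hv⟩, Or.inl ⟨_, rfl, rfl⟩, ?_⟩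
      rintro y (⟨c, rfl, rfl⟩ | ⟨c, rfl, rfl⟩)
      · rfl
      · exact ((hf c).2 hv).elim
    · refine ⟨c, Or.inr ⟨_, rfl, rfl⟩, ?_⟩
      rintro y (⟨d, hd, rfl⟩ | ⟨d, rfl, hd⟩)
      · exact ((hf c).2 (hd ▸ d.2)).elim
      · rw [hinj hd]
  refine ⟨_, hm, ?_⟩
  rw [← Nat.card_coe_set_eq, ← Nat.card_coe_set_eq]
  symm
  refine Nat.card_eq_of_bijective (fun c : C => ⟨s((c : V), f c), Or.inl ⟨c, rfl, rfl⟩⟩) ⟨?_, ?_⟩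
  · intro c d h
    have h' := congrArg Subtype.val h
    simp only [Sym2.eq_iff] at h'
    rcases h' with h' | h'
    · exact Subtype.ext h'.1
    · exact ((hf d).2 (h'.1 ▸ c.2)).elim
  · rintro ⟨e, he⟩
    induction e with
    | _ x y =>
      have he' := Subgraph.mem_edgeSet.1 he
      obtain ⟨c, hx, hy⟩ | ⟨c, hy, hx⟩ := he'
      · exact ⟨c, Subtype.ext (by simp only [hx, hy])⟩
      · exact ⟨c, Subtype.ext (by simp only [hx, hy, Sym2.eq_swap])⟩

theorem ncard_edgeSet_eq_tau (hA : A.IsBipartite) {M : A.Subgraph} (hM : IsMaxMatching A M) :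
    M.edgeSet.ncard = tau A := by
  obtain ⟨C, hC⟩ := exists_isMinVertexCover A
  obtain ⟨hcov, hcard⟩ := isMinVertexCover_iff.1 hC
  obtain ⟨f, hf, hf'⟩ := exists_injective_of_isMinVertexCover hA hC
  obtain ⟨N, hN, hN'⟩ := exists_isMatching_ncard_edgeSet f hf hf'
  refine le_antisymm (hcard ▸ ncard_edgeSet_le_of_isVertexCover hcov hM.1) ?_
  have := hM.2 N hN
  rw [← (Set.toFinite N.edgeSet).cast_ncard_eq, ← (Set.toFinite M.edgeSet).cast_ncard_eq, hN',
    hcard] at this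
  exact_mod_cast this

/-- A minimum vertex cover takes exactly one end of each edge of a maximum matching, and no
unmatched vertex. -/
theorem matched_of_isMinVertexCover (hC : IsMinVertexCover A C) (f : C → V)
    (hinj : Function.Injective f) (hf : ∀ x : C, A.Adj x (f x) ∧ f x ∉ C)
    (hD : IsMinVertexCover A D) :
    (∀ x : C, (x : V) ∈ D ↔ f x ∉ D) ∧ D ⊆ C ∪ Set.range f := by
  classical
  obtain ⟨hcovC, hcardC⟩ := isMinVertexCover_iff.1 hC
  obtain ⟨hcovD, hcardD⟩ := isMinVertexCover_iff.1 hD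
  -- `g` selects an end of `x — f x` lying in `D`. It is injective into `D`, and `|D| = |C|` makes
  -- it onto, so `D` has no room for a second end or for an unmatched vertex.
  let g : C → V := fun x => if (x : V) ∈ D then x else f x
  have hgD : ∀ x, g x ∈ D := by
    intro x
    simp only [g]
    split_ifs with h
    · exact h
    · exact (hcovD (hf x).1).resolve_left h
  have hg : Function.Injective g := by
    intro x y h
    simp only [g] at h
    split_ifs at h with h1 h2 h2
    · exact Subtype.ext h
    · exact ((hf y).2 (h ▸ x.2)).elim
    · exact ((hf x).2 (h ▸ y.2)).elim
    · exact hinj h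
  have hrange : Set.range g = D := by
    refine Set.eq_of_subset_of_ncard_le (by rintro _ ⟨x, rfl⟩; exact hgD x) ?_
    rw [← Nat.card_coe_set_eq (Set.range g), Nat.card_range_of_injective hg, Nat.card_coe_set_eq,
      hcardC, hcardD]
  have hcase : ∀ v ∈ D, ∃ y : C, ((y : V) ∈ D ∧ (y : V) = v) ∨ ((y : V) ∉ D ∧ f y = v) := by
    intro v hv
    rw [← hrange] at hv
    obtain ⟨y, hy⟩ := hv
    simp only [g] at hy
    split_ifs at hy with h
    · exact ⟨y, Or.inl ⟨h, hy⟩⟩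
    · exact ⟨y, Or.inr ⟨h, hy⟩⟩
  refine ⟨fun x => ⟨fun hx hfx => ?_, fun h => (hcovD (hf x).1).resolve_right h⟩, fun v hv => ?_⟩
  · obtain ⟨y, ⟨-, hy⟩ | ⟨hy, hy'⟩⟩ := hcase _ hfx
    · exact (hf x).2 (hy ▸ y.2)
    · rw [hinj hy'] at hy
      exact hy hx
  · obtain ⟨y, ⟨-, rfl⟩ | ⟨-, rfl⟩⟩ := hcase v hv
    · exact Or.inl y.2
    · exact Or.inr ⟨y, rfl⟩

/-- `C` is the disjoint union of the brown vertices and `S`, while the red vertices are `S` together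
with its partners `f '' S`. -/
theorem tau_eq_numBrown_add_numRed (hA : A.IsBipartite) :
    2 * tau A = 2 * numBrown A + numRed A := by
  obtain ⟨C, hC⟩ := exists_isMinVertexCover A
  have hcard := (isMinVertexCover_iff.1 hC).2
  obtain ⟨f, hinj, hf⟩ := exists_injective_of_isMinVertexCover hA hC
  have hD : ∀ D, IsMinVertexCover A D →
      (∀ x : C, (x : V) ∈ D ↔ f x ∉ D) ∧ D ⊆ C ∪ Set.range f :=
    fun D hD => matched_of_isMinVertexCover hC f hinj hf hD
  have hBC : brown A ⊆ C := fun v hv => hv C hC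
  set S : Set C := {x | (x : V) ∉ brown A} with hS
  have hdeg : ∀ x ∈ S, IsDegenerate A x ∧ IsDegenerate A (f x) := by
    intro x hx
    have hx' : ∃ D, IsMinVertexCover A D ∧ (x : V) ∉ D := by
      simpa [hS, brown, positiveBackbone] using hx
    obtain ⟨D, hDm, hxD⟩ := hx'
    exact ⟨⟨hx, fun h => h C hC x.2⟩, fun h => (hf x).2 (h C hC),
      fun h => h D hDm (not_not.1 fun h' => hxD (((hD D hDm).1 x).2 h'))⟩
  have hexcl : ∀ x ∈ S, IsExclusive A x (f x) := fun x hx =>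
    ⟨(hf x).1, (hdeg x hx).1, (hdeg x hx).2, fun D hDm h => ((hD D hDm).1 x).1 h.1 h.2⟩
  have hred : red A = Subtype.val '' S ∪ f '' S := by
    ext v
    constructor
    · rintro ⟨w, -, ⟨hv1, hv2⟩, -⟩
      have hv : ∃ D, IsMinVertexCover A D ∧ v ∈ D := by
        simpa [negativeBackbone] using hv2
      obtain ⟨D, hDm, hvD⟩ := hv
      rcases (hD D hDm).2 hvD with h | ⟨x, rfl⟩
      · exact Or.inl ⟨⟨v, h⟩, hv1, rfl⟩
      · refine Or.inr ⟨x, fun hx => ((hD D hDm).1 x).1 (hx D hDm) hvD, rfl⟩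
    · rintro (⟨x, hx, rfl⟩ | ⟨x, hx, rfl⟩)
      · exact ⟨_, hexcl x hx⟩
      · obtain ⟨h1, h2, h3, h4⟩ := hexcl x hx
        exact ⟨x, h1.symm, h3, h2, fun D hDm h => h4 D hDm h.symm⟩
  have h1 : numRed A = S.ncard + S.ncard := by
    rw [numRed, hred, Set.ncard_union_eq, Set.ncard_image_of_injective _ Subtype.val_injective,
      Set.ncard_image_of_injective _ hinj]
    rw [Set.disjoint_left]
    rintro _ ⟨x, -, rfl⟩ ⟨y, -, hy⟩
    exact (hf y).2 (hy ▸ x.2)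
  have h2 : numBrown A + S.ncard = C.ncard := by
    have : Subtype.val '' S = C \ brown A := by
      ext v
      simp [hS, and_comm]
    rw [← Set.ncard_image_of_injective S Subtype.val_injective, this, numBrown, add_comm]
    exact Set.ncard_sdiff_add_ncard_of_subset hBC
  omega

end Konig

/-! ### Covered roots, and invariance under isomorphism. -/

/-- `r` belongs to some minimum vertex cover of `A`. -/
def RootCovered {V : Type*} (A : SimpleGraph V) (r : V) : Prop :=
  ∃ C : Set V, IsMinVertexCover A C ∧ r ∈ C

section Iso

variable {V W : Type*} [Finite V] [Finite W] {A : SimpleGraph V} {B : SimpleGraph W}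

theorem tau_le_of_iso (e : A ≃g B) : tau A ≤ tau B := by
  obtain ⟨C, hC, hc⟩ := exists_cover_ncard_eq_tau B
  have := tau_le ((isVertexCover_preimage_iso e).2 hC)
  rwa [Set.ncard_preimage_of_injective_subset_range e.injective (by simp), hc] at this

theorem tau_eq_of_iso (e : A ≃g B) : tau A = tau B :=
  le_antisymm (tau_le_of_iso e) (tau_le_of_iso e.symm)

theorem RootCovered.of_iso (e : A ≃g B) {r : V} (h : RootCovered B (e r)) : RootCovered A r := by
  obtain ⟨C, hC, hr⟩ := h
  rw [isMinVertexCover_iff] at hC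
  refine ⟨e ⁻¹' C, isMinVertexCover_iff.2 ⟨(isVertexCover_preimage_iso e).2 hC.1, ?_⟩, hr⟩
  rw [Set.ncard_preimage_of_injective_subset_range e.injective (by simp), hC.2, tau_eq_of_iso e]

theorem rootCovered_iso_iff (e : A ≃g B) (r : V) : RootCovered B (e r) ↔ RootCovered A r :=
  ⟨RootCovered.of_iso e, fun h => RootCovered.of_iso e.symm (by simpa using h)⟩

end Iso

/-! ### Joining two rooted graphs by an edge between their roots. -/

section Glue

variable {α β : Type*}

/-- The disjoint union of two graphs, with an edge added between them. -/
def glue (B : SimpleGraph α) (C : SimpleGraph β) (v : α) (p : β) : SimpleGraph (α ⊕ β) :=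
  (B ⊕g C) ⊔ edge (.inl v) (.inr p)

variable {B : SimpleGraph α} {C : SimpleGraph β} {v : α} {p : β}

@[simp] theorem glue_adj_inl_inl {x y : α} : (glue B C v p).Adj (.inl x) (.inl y) ↔ B.Adj x y := by
  simp [glue, edge_adj]

@[simp] theorem glue_adj_inr_inr {x y : β} : (glue B C v p).Adj (.inr x) (.inr y) ↔ C.Adj x y := by
  simp [glue, edge_adj]

@[simp] theorem glue_adj_inl_inr {x : α} {y : β} :
    (glue B C v p).Adj (.inl x) (.inr y) ↔ x = v ∧ y = p := by
  simp [glue, edge_adj]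

@[simp] theorem glue_adj_inr_inl {x : α} {y : β} :
    (glue B C v p).Adj (.inr y) (.inl x) ↔ x = v ∧ y = p := by
  simp [glue, edge_adj, and_comm]

theorem isVertexCover_glue {D : Set (α ⊕ β)} : (glue B C v p).IsVertexCover D ↔
    B.IsVertexCover (Sum.inl ⁻¹' D) ∧ C.IsVertexCover (Sum.inr ⁻¹' D) ∧
      (Sum.inl v ∈ D ∨ Sum.inr p ∈ D) := by
  constructor
  · intro h
    exact ⟨fun x y hxy => h (glue_adj_inl_inl.2 hxy), fun x y hxy => h (glue_adj_inr_inr.2 hxy),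
      h (glue_adj_inl_inr.2 ⟨rfl, rfl⟩)⟩
  · rintro ⟨h1, h2, h3⟩ (x | x) (y | y) hxy
    · exact h1 (glue_adj_inl_inl.1 hxy)
    · obtain ⟨rfl, rfl⟩ := glue_adj_inl_inr.1 hxy
      exact h3
    · obtain ⟨rfl, rfl⟩ := glue_adj_inr_inl.1 hxy
      exact h3.symm
    · exact h2 (glue_adj_inr_inr.1 hxy)

variable [Finite α] [Finite β]

theorem isTree_glue (hB : B.IsTree) (hC : C.IsTree) : (glue B C v p).IsTree := by
  rw [isTree_iff_connected_and_card] at *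
  refine ⟨hB.1.sum_sup_edge hC.1, ?_⟩
  have h : (glue B C v p).edgeSet = insert s(.inl v, .inr p) (B ⊕g C).edgeSet := by
    rw [glue, edgeSet_sup, edgeSet_edge_of_ne (by simp), Set.union_singleton]
  rw [h, Nat.card_coe_set_eq, Set.ncard_insert_of_notMem (by simp), ← Nat.card_coe_set_eq,
    Nat.card_congr edgeSetSumEquiv, Nat.card_sum, Nat.card_sum]
  omega

theorem ncard_sum (D : Set (α ⊕ β)) :
    D.ncard = (Sum.inl ⁻¹' D).ncard + (Sum.inr ⁻¹' D).ncard := by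
  conv_lhs => rw [← Set.image_preimage_inl_union_image_preimage_inr D]
  rw [Set.ncard_union_eq, Set.ncard_image_of_injective _ Sum.inl_injective,
    Set.ncard_image_of_injective _ Sum.inr_injective]
  rw [Set.disjoint_left]
  rintro _ ⟨x, -, rfl⟩ ⟨y, -, h⟩
  cases h

/-- The sets of vertices of `α ⊕ β` are the pairs of a set on each side. -/
theorem exists_sum_set (D : Set α) (E : Set β) :
    ∃ F : Set (α ⊕ β), Sum.inl ⁻¹' F = D ∧ Sum.inr ⁻¹' F = E :=
  ⟨Sum.elim D E, rfl, rfl⟩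

theorem tau_lt_ncard_of_not_rootCovered {D : Set α} (hv : ¬ RootCovered B v)
    (hD : B.IsVertexCover D) (hvD : v ∈ D) : tau B < D.ncard :=
  lt_of_le_of_ne (tau_le hD) fun h => hv ⟨D, isMinVertexCover_iff.2 ⟨hD, h.symm⟩, hvD⟩

theorem exists_cover_insert (B : SimpleGraph α) (v : α) :
    ∃ D, B.IsVertexCover D ∧ v ∈ D ∧ D.ncard ≤ tau B + 1 := by
  obtain ⟨D, hD, hd⟩ := exists_cover_ncard_eq_tau B
  exact ⟨insert v D, hD.subset (Set.subset_insert _ _), Set.mem_insert _ _,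
    hd ▸ Set.ncard_insert_le _ _⟩

theorem exists_glue_cover {D : Set α} {E : Set β} (hD : B.IsVertexCover D)
    (hE : C.IsVertexCover E) (h : v ∈ D ∨ p ∈ E) :
    ∃ F, (glue B C v p).IsVertexCover F ∧ F.ncard = D.ncard + E.ncard ∧
      (p ∈ E → Sum.inr p ∈ F) := by
  obtain ⟨F, rfl, rfl⟩ := exists_sum_set D E
  exact ⟨F, isVertexCover_glue.2 ⟨hD, hE, h⟩, ncard_sum F, id⟩

theorem tau_add_tau_le_tau_glue : tau B + tau C ≤ tau (glue B C v p) := by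
  obtain ⟨F, hF, hf⟩ := exists_cover_ncard_eq_tau (glue B C v p)
  obtain ⟨h1, h2, -⟩ := isVertexCover_glue.1 hF
  rw [← hf, ncard_sum]
  exact add_le_add (tau_le h1) (tau_le h2)

theorem tau_glue_of_rootCovered (h : RootCovered B v ∨ RootCovered C p) :
    tau (glue B C v p) = tau B + tau C := by
  refine le_antisymm ?_ tau_add_tau_le_tau_glue
  rcases h with ⟨D, hD, hv⟩ | ⟨E, hE, hp⟩
  · rw [isMinVertexCover_iff] at hD
    obtain ⟨E, hE, he⟩ := exists_cover_ncard_eq_tau C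
    obtain ⟨F, hF, hf, -⟩ := exists_glue_cover (p := p) hD.1 hE (Or.inl hv)
    rw [← hD.2, ← he, ← hf]
    exact tau_le hF
  · rw [isMinVertexCover_iff] at hE
    obtain ⟨D, hD, hd⟩ := exists_cover_ncard_eq_tau B
    obtain ⟨F, hF, hf, -⟩ := exists_glue_cover (v := v) hD hE.1 (Or.inr hp)
    rw [← hd, ← hE.2, ← hf]
    exact tau_le hF

/-- The new edge forces one of the roots into the cover, and on that side the cover then exceeds the
minimum. -/
theorem tau_glue_of_not_rootCovered (hv : ¬ RootCovered B v) (hp : ¬ RootCovered C p) :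
    tau (glue B C v p) = tau B + tau C + 1 := by
  refine le_antisymm ?_ ?_
  · obtain ⟨D, hD, hvD, hd⟩ := exists_cover_insert B v
    obtain ⟨E, hE, he⟩ := exists_cover_ncard_eq_tau C
    obtain ⟨F, hF, hf, -⟩ := exists_glue_cover (p := p) hD hE (Or.inl hvD)
    have := tau_le hF
    omega
  · obtain ⟨F, hF, hf⟩ := exists_cover_ncard_eq_tau (glue B C v p)
    obtain ⟨h1, h2, h3⟩ := isVertexCover_glue.1 hF
    have := tau_le h1
    have := tau_le h2
    rw [ncard_sum] at hf
    rcases h3 with h3 | h3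
    · have := tau_lt_ncard_of_not_rootCovered hv h1 h3
      omega
    · have := tau_lt_ncard_of_not_rootCovered hp h2 h3
      omega

/-- If `C` has a minimum cover through `p`, it extends at no extra cost. If neither root is covered,
one extra vertex is needed anyway and may be `p`. In the remaining case the optimum is `tau B + tau
C`, and using `p` would exceed it. -/
theorem rootCovered_glue :
    RootCovered (glue B C v p) (.inr p) ↔ ¬ RootCovered B v ∨ RootCovered C p := by
  constructor
  · rintro ⟨F, hF, hp⟩
    by_contra! h
    obtain ⟨h1, h2⟩ := isMinVertexCover_iff.1 hF
    obtain ⟨h3, h4, -⟩ := isVertexCover_glue.1 h1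
    rw [tau_glue_of_rootCovered (Or.inl h.1), ncard_sum] at h2
    have := tau_le h3
    have := tau_lt_ncard_of_not_rootCovered h.2 h4 hp
    omega
  · intro h
    by_cases hp : RootCovered C p
    · obtain ⟨E, hE, hpE⟩ := hp
      obtain ⟨hE1, hE2⟩ := isMinVertexCover_iff.1 hE
      obtain ⟨D, hD, hd⟩ := exists_cover_ncard_eq_tau B
      obtain ⟨F, hF, hf, hpF⟩ := exists_glue_cover (v := v) hD hE1 (Or.inr hpE)
      refine ⟨F, isMinVertexCover_iff.2 ⟨hF, ?_⟩, hpF hpE⟩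
      rw [tau_glue_of_rootCovered (Or.inr ⟨E, hE, hpE⟩), hf, hd, hE2]
    · have hv := h.resolve_right hp
      obtain ⟨E, hE, hpE, he⟩ := exists_cover_insert C p
      obtain ⟨D, hD, hd⟩ := exists_cover_ncard_eq_tau B
      obtain ⟨F, hF, hf, hpF⟩ := exists_glue_cover (v := v) hD hE (Or.inr hpE)
      refine ⟨F, isMinVertexCover_iff.2 ⟨hF, le_antisymm ?_ (tau_le hF)⟩, hpF hpE⟩
      rw [tau_glue_of_not_rootCovered hv hp]
      omega

end Glue

/-! ### Splitting a tree on a fixed vertex set along an edge. -/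

section GlueOn

variable {V : Type*}

open Classical in
/-- The graph on `V` made of a graph on `S` and a graph on its complement, joined by the edge
`vp`. -/
noncomputable def glueOn (S : Finset V) (B : SimpleGraph {x // x ∈ S})
    (C : SimpleGraph {x // x ∉ S}) (v : {x // x ∈ S}) (p : {x // x ∉ S}) : SimpleGraph V :=
  (glue B C v p).comap (Equiv.sumCompl (· ∈ S)).symm

variable {S : Finset V} {B : SimpleGraph {x // x ∈ S}} {C : SimpleGraph {x // x ∉ S}}
  {v : {x // x ∈ S}} {p : {x // x ∉ S}}

open Classical in
/-- `glueOn` is a copy of `glue`. -/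
noncomputable def glueIso (S : Finset V) (B : SimpleGraph {x // x ∈ S})
    (C : SimpleGraph {x // x ∉ S}) (v : {x // x ∈ S}) (p : {x // x ∉ S}) :
    glue B C v p ≃g glueOn S B C v p where
  toEquiv := Equiv.sumCompl (· ∈ S)
  map_rel_iff' := by simp [glueOn]

theorem glueOn_adj_mem_mem (x y : {x // x ∈ S}) : (glueOn S B C v p).Adj x y ↔ B.Adj x y := by
  simp [glueOn]

theorem glueOn_adj_notMem_notMem (x y : {x // x ∉ S}) :
    (glueOn S B C v p).Adj x y ↔ C.Adj x y := by
  simp [glueOn]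

theorem glueOn_adj_mem_notMem (x : {x // x ∈ S}) (y : {x // x ∉ S}) :
    (glueOn S B C v p).Adj x y ↔ x = v ∧ y = p := by
  simp [glueOn]

theorem isTree_glueOn [Finite V] (hB : B.IsTree) (hC : C.IsTree) : (glueOn S B C v p).IsTree :=
  (glueIso S B C v p).isTree_iff.1 (isTree_glue hB hC)

/-- Uniqueness of the splitting: an edge leaving `S'` ends at `p`, which is not in `S`, so the
connected graph `B` started at `w` cannot leave `S'`. -/
theorem subset_of_glueOn_eq {S' : Finset V} {B' : SimpleGraph {x // x ∈ S'}}
    {C' : SimpleGraph {x // x ∉ S'}} {v' : {x // x ∈ S'}} {p' : {x // x ∉ S'}}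
    (hB : B.Connected) (h : glueOn S B C v p = glueOn S' B' C' v' p') (hp : (p : V) = p')
    {w : V} (hw : w ∈ S) (hw' : w ∈ S') : S ⊆ S' := by
  intro x hx
  have hr := (reachable_iff_reflTransGen _ _).1 (hB.preconnected ⟨w, hw⟩ ⟨x, hx⟩)
  suffices ∀ y : {x // x ∈ S}, Relation.ReflTransGen B.Adj ⟨w, hw⟩ y → (y : V) ∈ S' from
    this _ hr
  intro y hy
  induction hy with
  | refl => exact hw'
  | @tail y z _ hyz ih =>
    by_contra hz
    have h1 := (glueOn_adj_mem_mem (C := C) (v := v) (p := p) y z).2 hyz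
    rw [h] at h1
    have h2 := (glueOn_adj_mem_notMem (S := S') ⟨(y : V), ih⟩ ⟨(z : V), hz⟩).1 h1
    have h3 : (z : V) = p' := congrArg Subtype.val h2.2
    exact p.2 (hp ▸ h3 ▸ z.2)

/-- A tree splits at the first edge of the path from `p` to `w`. -/
theorem IsTree.exists_split [Finite V] {A : SimpleGraph V} (hA : A.IsTree) {p w : V}
    (hpw : w ≠ p) : ∃ (S : Finset V) (v : {x // x ∈ S}) (hp : p ∉ S) (_ : w ∈ S),
      (A.comap ((↑) : {x // x ∈ S} → V)).IsTree ∧ (A.comap ((↑) : {x // x ∉ S} → V)).IsTree ∧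
        A = glueOn S (A.comap (↑)) (A.comap (↑)) v ⟨p, hp⟩ := by
  classical
  have := Fintype.ofFinite V
  obtain ⟨q, hq⟩ := hA.connected.preconnected.exists_isPath p w
  cases q with
  | nil => exact (hpw rfl).elim
  | @cons _ v _ hpv q =>
    rw [Walk.cons_isPath_iff] at hq
    -- `pv` is the first edge of the path and a bridge. Deleting it leaves exactly the components of
    -- `v` and of `p`; `S` will be the former, which contains `w` because the rest of the path
    -- avoids `p`.
    set A' := A.deleteEdges {s(p, v)} with hA'
    have hle : A' ≤ A := deleteEdges_le _
    have hadj : ∀ x y, A.Adj x y → A'.Adj x y ∨ (x = p ∧ y = v) ∨ (x = v ∧ y = p) := by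
      intro x y h
      rw [hA', deleteEdges_adj, Set.mem_singleton_iff, Sym2.eq_iff]
      tauto
    have hvw : A'.Reachable v w :=
      ⟨q.toDeleteEdges _ fun e he h => hq.2 (Walk.fst_mem_support_of_mem_edges _ (h ▸ he))⟩
    have hnp : ¬ A'.Reachable v p := fun h =>
      isBridge_iff.1 (isAcyclic_iff_forall_adj_isBridge.1 hA.isAcyclic hpv) h.symm
    have hall : ∀ x, A'.Reachable v x ∨ A'.Reachable p x := by
      intro x
      have hr := (reachable_iff_reflTransGen _ _).1 (hA.connected.preconnected p x)
      induction hr with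
      | refl => exact Or.inr (Reachable.refl _)
      | @tail y z _ hyz ih =>
        rcases hadj _ _ hyz with h | ⟨rfl, rfl⟩ | ⟨rfl, rfl⟩
        · exact ih.imp (fun i => i.trans h.reachable) (fun i => i.trans h.reachable)
        · exact Or.inl (Reachable.refl _)
        · exact Or.inr (Reachable.refl _)
    set S : Finset V := Finset.univ.filter fun x => A'.Reachable v x with hS
    have hmem : ∀ x, x ∈ S ↔ A'.Reachable v x := by simp [hS]
    have hnmem : ∀ x, x ∉ S ↔ A'.Reachable p x := fun x => by
      rw [hmem]
      exact ⟨fun h => (hall x).resolve_left h, fun h h' => hnp (h'.trans h.symm)⟩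
    have hconn : ∀ (P : V → Prop) (r : V), (∀ x, P x ↔ A'.Reachable r x) →
        (A.comap ((↑) : {x // P x} → V)).IsTree := by
      intro P r hP
      refine ⟨?_, hA.isAcyclic.of_comap ⟨_, Subtype.val_injective⟩⟩
      have hr : P r := (hP r).2 (Reachable.refl _)
      have : ∀ x, Relation.ReflTransGen A'.Adj r x → ∀ hx : P x,
          (A.comap ((↑) : {x // P x} → V)).Reachable ⟨r, hr⟩ ⟨x, hx⟩ := by
        intro x h
        induction h with
        | refl => exact fun _ => Reachable.refl _
        | @tail y z hy hyz ih =>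
          intro hz
          have hPy : P y := (hP y).2 ((reachable_iff_reflTransGen _ _).2 hy)
          exact (ih hPy).trans (Adj.reachable (show A.Adj y z from hle hyz))
      have hreach := fun x : {x // P x} =>
        this x ((reachable_iff_reflTransGen _ _).1 ((hP x).1 x.2)) x.2
      have : Nonempty {x // P x} := ⟨⟨r, hr⟩⟩
      exact ⟨fun x y => (hreach x).symm.trans (hreach y)⟩
    have hv : v ∈ S := (hmem v).2 (Reachable.refl _)
    have hp : p ∉ S := (hnmem p).2 (Reachable.refl _)
    have hcross : ∀ x y, x ∈ S → y ∉ S → (A.Adj x y ↔ x = v ∧ y = p) := by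
      intro x y hx hy
      constructor
      · intro h
        rcases hadj _ _ h with h | ⟨rfl, rfl⟩ | h
        · exact (hy ((hmem y).2 (((hmem x).1 hx).trans h.reachable))).elim
        · exact (hp hx).elim
        · exact h
      · rintro ⟨rfl, rfl⟩
        exact hpv.symm
    refine ⟨S, ⟨v, hv⟩, hp, (hmem w).2 hvw, hconn _ v hmem, hconn _ p hnmem, ?_⟩
    ext x y
    by_cases hx : x ∈ S <;> by_cases hy : y ∈ S
    · refine Iff.trans ?_ (glueOn_adj_mem_mem (S := S) ⟨x, hx⟩ ⟨y, hy⟩).symm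
      rfl
    · rw [hcross x y hx hy]
      refine Iff.trans ?_ (glueOn_adj_mem_notMem ⟨x, hx⟩ ⟨y, hy⟩).symm
      simp
    · rw [adj_comm, adj_comm (glueOn _ _ _ _ _), hcross y x hy hx]
      refine Iff.trans ?_ (glueOn_adj_mem_notMem ⟨y, hy⟩ ⟨x, hx⟩).symm
      simp
    · refine Iff.trans ?_ (glueOn_adj_notMem_notMem (S := S) ⟨x, hx⟩ ⟨y, hy⟩).symm
      rfl

end GlueOn

/-! ### The recursion for sums over rooted trees. -/

section Sums

/-- The trees with vertex set `W`. -/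
abbrev LTree (W : Type) := {A : SimpleGraph W // A.IsTree}

noncomputable instance (W : Type) [Finite W] : Fintype (LTree W) := Fintype.ofFinite _

/-- The sum of a function of rooted graphs over all rooted trees with vertex set `W`. -/
noncomputable def rootedSum (φ : (W : Type) → SimpleGraph W → W → ℝ) (W : Type) [Fintype W] : ℝ :=
  ∑ A : LTree W, ∑ x, φ W A.1 x

/-- A function of rooted graphs is invariant under isomorphism. -/
def IsoInvariant (φ : (W : Type) → SimpleGraph W → W → ℝ) : Prop :=
  ∀ (W W' : Type) [Finite W] [Finite W'] (A : SimpleGraph W) (B : SimpleGraph W') (e : A ≃g B)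
    (x : W), φ W' B (e x) = φ W A x

theorem IsoInvariant.rootedSum_eq {φ : (W : Type) → SimpleGraph W → W → ℝ} (hφ : IsoInvariant φ)
    {W W' : Type} [Fintype W] [Fintype W'] (e : W ≃ W') : rootedSum φ W = rootedSum φ W' := by
  let g : LTree W → LTree W' := fun A =>
    ⟨A.1.map e.toEmbedding, (SimpleGraph.Iso.map e A.1).isTree_iff.1 A.2⟩
  have hg : Function.Bijective g := by
    constructor
    · intro A B h
      have := congrArg Subtype.val h
      exact Subtype.ext (SimpleGraph.map_injective e.toEmbedding this)
    · intro B
      refine ⟨⟨B.1.map e.symm.toEmbedding, (SimpleGraph.Iso.map e.symm B.1).isTree_iff.1 B.2⟩, ?_⟩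
      apply Subtype.ext
      ext x y
      simp [g]
  rw [rootedSum, rootedSum, ← hg.sum_comp]
  refine Finset.sum_congr rfl fun A _ => ?_
  rw [← e.sum_comp]
  exact Finset.sum_congr rfl fun x _ => (hφ W W' A.1 _ (SimpleGraph.Iso.map e A.1) x).symm

/-- A decomposition of a tree with two distinct marked vertices. -/
abbrev Split (V : Type) :=
  Σ S : Finset V, (LTree {x // x ∈ S} × {x // x ∈ S}) × (LTree {x // x ∉ S} × {x // x ∉ S}) ×
    {x // x ∈ S}

/-- The tree with two distinct marked vertices given by a decomposition. -/
noncomputable def Split.glue {V : Type} [Finite V] (s : Split V) :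
    LTree V × Σ p : V, {w : V // w ≠ p} :=
  (⟨glueOn s.1 s.2.1.1.1 s.2.2.1.1.1 s.2.1.2 s.2.2.1.2, isTree_glueOn s.2.1.1.2 s.2.2.1.1.2⟩,
    ⟨s.2.2.1.2, s.2.2.2, fun h => s.2.2.1.2.2 (h ▸ s.2.2.2.2)⟩)

theorem Split.glue_bijective (V : Type) [Finite V] :
    Function.Bijective (Split.glue : Split V → _) := by
  constructor
  · rintro ⟨S, ⟨⟨B, hB⟩, v⟩, ⟨⟨C, hC⟩, p⟩, w⟩ ⟨S', ⟨⟨B', hB'⟩, v'⟩, ⟨⟨C', hC'⟩, p'⟩, w'⟩ h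
    simp only [Split.glue, Prod.mk.injEq, Subtype.mk.injEq] at h
    obtain ⟨h1, h2⟩ := h
    have hp : (p : V) = p' := congrArg Sigma.fst h2
    have hw : (w : V) = w' := congrArg (fun z : Σ p : V, {w : V // w ≠ p} => (z.2 : V)) h2
    have hSS : S = S' := subset_antisymm
      (subset_of_glueOn_eq hB.connected h1 hp w.2 (hw ▸ w'.2))
      (subset_of_glueOn_eq hB'.connected h1.symm hp.symm w'.2 (hw ▸ w.2))
    subst hSS
    obtain rfl := Subtype.ext hp
    obtain rfl := Subtype.ext hw
    have hBB : B = B' := by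
      ext x y
      rw [← glueOn_adj_mem_mem (C := C) (v := v) (p := p), h1, glueOn_adj_mem_mem]
    have hCC : C = C' := by
      ext x y
      rw [← glueOn_adj_notMem_notMem (B := B) (v := v) (p := p), h1, glueOn_adj_notMem_notMem]
    have hv : v = v' := by
      have := (glueOn_adj_mem_notMem (B := B) (C := C) (v := v) (p := p) v p).2 ⟨rfl, rfl⟩
      rw [h1, glueOn_adj_mem_notMem] at this
      exact this.1
    subst hBB hCC hv
    rfl
  · rintro ⟨⟨A, hA⟩, p, w, hwp⟩
    obtain ⟨S, v, hp, hw, hB, hC, h⟩ := IsTree.exists_split hA hwp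
    refine ⟨⟨S, (⟨_, hB⟩, v), (⟨_, hC⟩, ⟨p, hp⟩), ⟨w, hw⟩⟩, ?_⟩
    simp only [Split.glue, Prod.mk.injEq, Subtype.mk.injEq]
    exact ⟨h.symm, trivial⟩

/-- Double count of a tree with root `p` and second mark `w ≠ p`. The weight does not see `w`, which
contributes `card V - 1` before the splitting and `S.card` after it. -/
theorem rootedSum_eq_sum_glueOn (φ : (W : Type) → SimpleGraph W → W → ℝ) (V : Type) [Fintype V]
    [DecidableEq V] : ((Fintype.card V : ℝ) - 1) * rootedSum φ V =
      ∑ S : Finset V, (S.card : ℝ) * ∑ B : LTree {x // x ∈ S}, ∑ v : {x // x ∈ S},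
        ∑ C : LTree {x // x ∉ S}, ∑ p : {x // x ∉ S}, φ V (glueOn S B.1 C.1 v p) p := by
  have h1 : ∑ x : LTree V × Σ p : V, {w : V // w ≠ p}, φ V x.1.1 x.2.1 =
      ((Fintype.card V : ℝ) - 1) * rootedSum φ V := by
    rw [Fintype.sum_prod_type, rootedSum, Finset.mul_sum]
    refine Finset.sum_congr rfl fun A _ => ?_
    rw [Fintype.sum_sigma, Finset.mul_sum]
    refine Finset.sum_congr rfl fun p _ => ?_
    have hc : (Fintype.card {w : V // w ≠ p} : ℝ) = Fintype.card V - 1 := by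
      have : 0 < Fintype.card V := Fintype.card_pos_iff.2 ⟨p⟩
      rw [Fintype.card_subtype_compl, Fintype.card_subtype_eq, Nat.cast_sub this, Nat.cast_one]
    simp only [Finset.sum_const, Finset.card_univ, nsmul_eq_mul, hc]
  rw [← h1, ← (Split.glue_bijective V).sum_comp, Fintype.sum_sigma]
  refine Finset.sum_congr rfl fun S _ => ?_
  simp only [Fintype.sum_prod_type, Split.glue, Finset.sum_const, Finset.card_univ, nsmul_eq_mul,
    Fintype.card_coe, ← Finset.mul_sum]

/-- The sum of a function of rooted graphs over the rooted labelled trees on `n` vertices. -/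
noncomputable def rootedSeq (φ : (W : Type) → SimpleGraph W → W → ℝ) (n : ℕ) : ℝ :=
  rootedSum φ (Fin n)

theorem sum_four_comm {ι P Q R T : Type*} [Fintype P] [Fintype Q] [Fintype R] [Fintype T]
    (I : Finset ι) (a : ι → P → Q → ℝ) (b : ι → R → T → ℝ) :
    ∑ x, ∑ y, ∑ z, ∑ t, ∑ i ∈ I, a i x y * b i z t =
      ∑ i ∈ I, (∑ x, ∑ y, a i x y) * ∑ z, ∑ t, b i z t := by
  simp_rw [Finset.sum_mul, Finset.mul_sum]
  rw [Finset.sum_comm (s := I)]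
  refine Finset.sum_congr rfl fun x _ => ?_
  rw [Finset.sum_comm (s := I)]
  refine Finset.sum_congr rfl fun y _ => ?_
  rw [Finset.sum_comm (s := I)]
  refine Finset.sum_congr rfl fun z _ => ?_
  rw [Finset.sum_comm (s := I)]

/-- By invariance each inner sum depends only on the size of `S`. A finite sum of products is
allowed because the cover number needs three of them. -/
theorem rootedSeq_recursion {ι : Type*} (I : Finset ι) {φ : (W : Type) → SimpleGraph W → W → ℝ}
    {a b : ι → (W : Type) → SimpleGraph W → W → ℝ}
    (hφ : IsoInvariant φ) (ha : ∀ i, IsoInvariant (a i)) (hb : ∀ i, IsoInvariant (b i))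
    (h : ∀ (α β : Type) [Finite α] [Finite β] (B : SimpleGraph α) (C : SimpleGraph β) (v : α)
      (p : β), φ _ (glue B C v p) (.inr p) = ∑ i ∈ I, a i α B v * b i β C p) (n : ℕ) :
    ((n : ℝ) - 1) * rootedSeq φ n = ∑ k ∈ Finset.range (n + 1),
      (n.choose k : ℝ) * (k * ∑ i ∈ I, rootedSeq (a i) k * rootedSeq (b i) (n - k)) := by
  have h1 := rootedSum_eq_sum_glueOn φ (Fin n)
  rw [Fintype.card_fin] at h1
  rw [rootedSeq, h1]
  have h2 := Finset.sum_powerset_apply_card (x := (Finset.univ : Finset (Fin n)))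
    fun k => (k : ℝ) * ∑ i ∈ I, rootedSeq (a i) k * rootedSeq (b i) (n - k)
  simp only [Finset.powerset_univ, Finset.card_univ, Fintype.card_fin, nsmul_eq_mul] at h2
  rw [← h2]
  refine Finset.sum_congr rfl fun S _ => ?_
  congr 1
  have e1 : {x // x ∈ S} ≃ Fin S.card := S.equivFin
  have e2 : {x // x ∉ S} ≃ Fin (n - S.card) := Fintype.equivFinOfCardEq (by
    rw [Fintype.card_subtype_compl, Fintype.card_fin, Fintype.card_coe])
  simp only [rootedSeq]
  simp only [← (ha _).rootedSum_eq e1, ← (hb _).rootedSum_eq e2]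
  have h3 : ∀ (B : LTree {x // x ∈ S}) (v : {x // x ∈ S}) (C : LTree {x // x ∉ S})
      (p : {x // x ∉ S}), φ (Fin n) (glueOn S B.1 C.1 v p) p =
        ∑ i ∈ I, a i _ B.1 v * b i _ C.1 p := by
    intro B v C p
    rw [← h, ← hφ _ _ _ _ (glueIso S B.1 C.1 v p)]
    rfl
  simp only [h3, rootedSum]
  exact sum_four_comm I (fun i (B : LTree {x // x ∈ S}) v => a i _ B.1 v)
    fun i (C : LTree {x // x ∉ S}) p => b i _ C.1 p

end Sums

/-! ### The three weights, their recursions and initial values. -/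

section Weights

open Classical in
/-- The indicator of the roots that belong to a minimum vertex cover. -/
noncomputable def coveredWeight (W : Type) (A : SimpleGraph W) (x : W) : ℝ :=
  if RootCovered A x then 1 else 0

open Classical in
/-- The indicator of the roots that belong to no minimum vertex cover. -/
noncomputable def uncoveredWeight (W : Type) (A : SimpleGraph W) (x : W) : ℝ :=
  if RootCovered A x then 0 else 1

/-- The constant weight. -/
def unitWeight (W : Type) (_ : SimpleGraph W) (_ : W) : ℝ := 1

/-- The vertex cover number as a weight. -/
noncomputable def tauWeight (W : Type) (A : SimpleGraph W) (_ : W) : ℝ := tau A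

theorem isoInvariant_covered : IsoInvariant coveredWeight := by
  intro W W' _ _ A B e x
  unfold coveredWeight
  congr 1
  exact propext (rootCovered_iso_iff e x)

theorem isoInvariant_uncovered : IsoInvariant uncoveredWeight := by
  intro W W' _ _ A B e x
  unfold uncoveredWeight
  congr 1
  exact propext (rootCovered_iso_iff e x)

theorem isoInvariant_unit : IsoInvariant unitWeight := fun _ _ _ _ _ _ _ _ => rfl

theorem isoInvariant_tau : IsoInvariant tauWeight := by
  intro W W' _ _ A B e x
  simp only [tauWeight, tau_eq_of_iso e]

/-- The number of rooted labelled trees on `n` vertices. -/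
noncomputable def numRooted (n : ℕ) : ℝ := rootedSeq unitWeight n

/-- The number of rooted labelled trees whose root is in a minimum vertex cover. -/
noncomputable def numCovered (n : ℕ) : ℝ := rootedSeq coveredWeight n

/-- The number of rooted labelled trees whose root is in no minimum vertex cover. -/
noncomputable def numUncovered (n : ℕ) : ℝ := rootedSeq uncoveredWeight n

/-- The sum of the vertex cover numbers of the rooted labelled trees on `n` vertices. -/
noncomputable def sumTau (n : ℕ) : ℝ := rootedSeq tauWeight n

theorem numRooted_recursion (n : ℕ) : ((n : ℝ) - 1) * numRooted n =
    ∑ k ∈ Finset.range (n + 1), (n.choose k : ℝ) * (k * (numRooted k * numRooted (n - k))) := by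
  have := rootedSeq_recursion (Finset.univ : Finset Unit) (φ := unitWeight)
    (a := fun _ => unitWeight) (b := fun _ => unitWeight) isoInvariant_unit
    (fun _ => isoInvariant_unit) (fun _ => isoInvariant_unit)
    (by intros; simp [unitWeight]) n
  simpa [numRooted] using this

theorem numUncovered_recursion (n : ℕ) : ((n : ℝ) - 1) * numUncovered n =
    ∑ k ∈ Finset.range (n + 1), (n.choose k : ℝ) *
      (k * (numCovered k * numUncovered (n - k))) := by
  have := rootedSeq_recursion (Finset.univ : Finset Unit) (φ := uncoveredWeight)
    (a := fun _ => coveredWeight) (b := fun _ => uncoveredWeight) isoInvariant_uncovered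
    (fun _ => isoInvariant_covered) (fun _ => isoInvariant_uncovered)
    (by
      intro α β _ _ B C v p
      by_cases h1 : RootCovered B v <;> by_cases h2 : RootCovered C p <;>
        simp [uncoveredWeight, coveredWeight, rootCovered_glue, h1, h2]) n
  simpa [numCovered, numUncovered] using this

/-- `tau` of a glued graph is `tau B · 1 + 1 · tau C` plus the product of the two indicators of
uncovered roots. -/
theorem sumTau_recursion (n : ℕ) : ((n : ℝ) - 1) * sumTau n =
    ∑ k ∈ Finset.range (n + 1), (n.choose k : ℝ) *
      (k * (sumTau k * numRooted (n - k) + numRooted k * sumTau (n - k) +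
        numUncovered k * numUncovered (n - k))) := by
  have := rootedSeq_recursion (Finset.univ : Finset (Fin 3)) (φ := tauWeight)
    (a := fun i => if i = 0 then tauWeight else if i = 1 then unitWeight else uncoveredWeight)
    (b := fun i => if i = 0 then unitWeight else if i = 1 then tauWeight else uncoveredWeight) isoInvariant_tau
    (by
      intro i
      fin_cases i
      exacts [isoInvariant_tau, isoInvariant_unit, isoInvariant_uncovered])
    (by
      intro i
      fin_cases i
      exacts [isoInvariant_unit, isoInvariant_tau, isoInvariant_uncovered])
    (by
      intro α β _ _ B C v p
      by_cases h1 : RootCovered B v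
      · simp [Fin.sum_univ_three, tauWeight, unitWeight, uncoveredWeight, h1,
          tau_glue_of_rootCovered (Or.inl h1)]
      · by_cases h2 : RootCovered C p
        · simp [Fin.sum_univ_three, tauWeight, unitWeight, uncoveredWeight, h2,
            tau_glue_of_rootCovered (Or.inr h2)]
        · simp [Fin.sum_univ_three, tauWeight, unitWeight, uncoveredWeight, h1, h2,
            tau_glue_of_not_rootCovered h1 h2]) n
  simpa [Fin.sum_univ_three, sumTau, numRooted, numUncovered] using this

theorem rootedSeq_zero (φ : (W : Type) → SimpleGraph W → W → ℝ) : rootedSeq φ 0 = 0 := by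
  simp [rootedSeq, rootedSum]

theorem rootedSeq_one (φ : (W : Type) → SimpleGraph W → W → ℝ) :
    rootedSeq φ 1 = φ (Fin 1) ⊥ 0 := by
  have : Unique (LTree (Fin 1)) :=
    ⟨⟨⟨⊥, IsTree.of_subsingleton⟩⟩, fun A => Subtype.ext (Subsingleton.elim _ _)⟩
  rw [rootedSeq, rootedSum, Fintype.sum_unique, Fin.sum_univ_one]
  congr 1
  exact Subsingleton.elim _ _

theorem tau_bot_fin_one : tau (⊥ : SimpleGraph (Fin 1)) = 0 := by
  simp [tau]

theorem not_rootCovered_fin_one : ¬ RootCovered (⊥ : SimpleGraph (Fin 1)) 0 := by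
  rintro ⟨C, hC, h⟩
  rw [isMinVertexCover_iff, tau_bot_fin_one, Set.ncard_eq_zero] at hC
  simp [hC.2] at h

theorem numRooted_one : numRooted 1 = 1 := by
  rw [numRooted, rootedSeq_one, unitWeight]

theorem numUncovered_one : numUncovered 1 = 1 := by
  rw [numUncovered, rootedSeq_one, uncoveredWeight, if_neg not_rootCovered_fin_one]

theorem numCovered_one : numCovered 1 = 0 := by
  rw [numCovered, rootedSeq_one, coveredWeight, if_neg not_rootCovered_fin_one]

theorem sumTau_one : sumTau 1 = 0 := by
  rw [sumTau, rootedSeq_one, tauWeight, tau_bot_fin_one, Nat.cast_zero]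

theorem numCovered_add_numUncovered (n : ℕ) : numCovered n + numUncovered n = numRooted n := by
  simp only [numCovered, numUncovered, numRooted, rootedSeq, rootedSum, ← Finset.sum_add_distrib]
  refine Finset.sum_congr rfl fun A _ => Finset.sum_congr rfl fun x _ => ?_
  by_cases h : RootCovered A.1 x <;> simp [coveredWeight, uncoveredWeight, unitWeight, h]

theorem numCovered_nonneg (n : ℕ) : 0 ≤ numCovered n := by
  refine Finset.sum_nonneg fun A _ => Finset.sum_nonneg fun x _ => ?_
  unfold coveredWeight
  split_ifs <;> norm_num

theorem numUncovered_nonneg (n : ℕ) : 0 ≤ numUncovered n := by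
  refine Finset.sum_nonneg fun A _ => Finset.sum_nonneg fun x _ => ?_
  unfold uncoveredWeight
  split_ifs <;> norm_num

end Weights

/-! ### Abel's binomial identity. -/

section Cayley

/-- The number `n ^ (n - 1)`, with the value `0` at `n = 0`. -/
noncomputable def cayley (n : ℕ) : ℝ := if n = 0 then 0 else (n : ℝ) ^ (n - 1)

theorem cayley_zero : cayley 0 = 0 := by simp [cayley]

theorem cayley_of_pos {n : ℕ} (hn : 1 ≤ n) : cayley n = (n : ℝ) ^ (n - 1) := by
  rw [cayley, if_neg (by omega)]

/-- Induction on `n` for all `y` at once: differentiating in `y` gives a multiple of the previous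
case, so only the value at `y = 0` remains. -/
theorem sum_choose_mul_cayley (n : ℕ) (y : ℝ) :
    ∑ k ∈ Finset.range (n + 2), ((n + 1).choose k : ℝ) * cayley k * (y - k) ^ (n + 1 - k) =
      (n + 1) * y ^ n := by
  induction n generalizing y with
  | zero => simp [Finset.sum_range_succ, cayley]
  | succ n ih =>
    set F : ℝ → ℝ := fun y => ∑ k ∈ Finset.range (n + 3),
      ((n + 2).choose k : ℝ) * cayley k * (y - k) ^ (n + 2 - k) - (n + 2) * y ^ (n + 1) with hF
    have hderiv : ∀ y, HasDerivAt F 0 y := by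
      intro y
      have h1 : HasDerivAt F (∑ k ∈ Finset.range (n + 3),
          ((n + 2).choose k : ℝ) * cayley k * (((n + 2 - k : ℕ) : ℝ) * (y - k) ^ (n + 2 - k - 1) * 1)
            - (n + 2) * (((n + 1 : ℕ) : ℝ) * y ^ n)) y := by
        refine HasDerivAt.sub (HasDerivAt.fun_sum fun k _ => ?_) ?_
        · exact (((hasDerivAt_id y).sub_const (k : ℝ)).pow (n + 2 - k)).const_mul _
        · exact (hasDerivAt_pow (n + 1) y).const_mul _
      convert h1 using 1
      rw [Finset.sum_range_succ]
      have h2 : ∀ k ∈ Finset.range (n + 2), ((n + 2).choose k : ℝ) * cayley k *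
          (((n + 2 - k : ℕ) : ℝ) * (y - k) ^ (n + 2 - k - 1) * 1) =
          (n + 2) * (((n + 1).choose k : ℝ) * cayley k * (y - k) ^ (n + 1 - k)) := by
        intro k hk
        have hk' : k ≤ n + 1 := by simpa [Nat.lt_succ_iff] using hk
        have h3 : (n + 2).choose k * (n + 2 - k) = (n + 2) * (n + 1).choose k := by
          have := Nat.choose_mul_succ_eq (n + 1) k
          rw [mul_comm (n + 2)]
          exact this.symm
        have h4 : ((n + 2).choose k : ℝ) * ((n + 2 - k : ℕ) : ℝ) =
            (n + 2) * ((n + 1).choose k : ℝ) := by exact_mod_cast h3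
        rw [show n + 2 - k - 1 = n + 1 - k by omega]
        linear_combination cayley k * (y - k) ^ (n + 1 - k) * h4
      rw [Finset.sum_congr rfl h2, ← Finset.mul_sum, ih]
      push_cast
      simp
    have hconst : F y = F 0 :=
      is_const_of_deriv_eq_zero (fun y => (hderiv y).differentiableAt) (fun y => (hderiv y).deriv)
        y 0
    have h0 : F 0 = 0 := by
      -- At `y = 0` the powers of `k` merge into `±k ^ (n + 1)`, and the sum is the finite
      -- difference of order `n + 2` of a polynomial of degree `n + 1`.
      have h5 := Finset.sum_congr rfl fun k (hk : k ∈ Finset.range (n + 3)) =>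
        show ((n + 2).choose k : ℝ) * cayley k * (0 - k) ^ (n + 2 - k) =
          ((-1) ^ (n + 2 - k) * ((n + 2).choose k : ℤ)) • ((0 : ℝ) + k • (1 : ℝ)) ^ (n + 1) by
        rcases Nat.eq_zero_or_pos k with rfl | hk0
        · simp [cayley]
        · have hk' : k ≤ n + 2 := by simpa [Nat.lt_succ_iff] using hk
          rw [cayley_of_pos hk0, zero_sub, neg_pow, zsmul_eq_mul]
          have : (k : ℝ) ^ (n + 1) = k ^ (k - 1) * k ^ (n + 2 - k) := by
            rw [← pow_add]
            congr 1
            omega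
          push_cast
          rw [nsmul_eq_mul, mul_one, zero_add, this]
          ring
      simp only [hF]
      rw [h5, ← fwdDiff_iter_eq_sum_shift (1 : ℝ) (fun x => x ^ (n + 1)) (n + 2) 0,
        fwdDiff_iter_pow_eq_zero_of_lt (by omega)]
      simp
    have := hconst.trans h0
    simp only [hF, sub_eq_zero] at this
    rw [this]
    push_cast
    ring

end Cayley

/-! ### Cayley's formula for rooted trees. -/

section CayleyFormula

theorem sum_choose_mul_cayley_mul_pow {n : ℕ} (hn : 1 ≤ n) :
    ∑ k ∈ Finset.range (n + 1), (n.choose k : ℝ) * (cayley k * ((n - k : ℕ) : ℝ) ^ (n - k)) =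
      (n : ℝ) ^ n := by
  obtain ⟨m, rfl⟩ : ∃ m, n = m + 1 := ⟨n - 1, by omega⟩
  have h := sum_choose_mul_cayley m ((m + 1 : ℕ) : ℝ)
  rw [← Nat.cast_succ, ← pow_succ'] at h
  rw [← h]
  refine Finset.sum_congr rfl fun k hk => ?_
  rw [Nat.cast_sub (by simpa [Nat.lt_succ_iff] using hk), mul_assoc]

/-- After `k ↦ n - k`, the factor `k * cayley k` becomes a power as in Abel's identity. The one
discrepancy is the term `k = n`: `cayley n` there (from `0 ^ 0 = 1`), zero here. -/
theorem sum_choose_mul_cayley_mul_cayley {n : ℕ} (hn : 1 ≤ n) :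
    ∑ k ∈ Finset.range (n + 1), (n.choose k : ℝ) * (k * (cayley k * cayley (n - k))) =
      ((n : ℝ) - 1) * cayley n := by
  have h1 := sum_choose_mul_cayley_mul_pow hn
  rw [Finset.sum_range_succ] at h1
  rw [← Finset.sum_range_reflect, Nat.add_sub_cancel, Finset.sum_range_succ]
  have h2 : ∀ k ∈ Finset.range n, (n.choose (n + 1 - 1 - k) : ℝ) *
      ((n + 1 - 1 - k : ℕ) * (cayley (n + 1 - 1 - k) * cayley (n - (n + 1 - 1 - k)))) =
      (n.choose k : ℝ) * (cayley k * ((n - k : ℕ) : ℝ) ^ (n - k)) := by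
    intro k hk
    have hk : k < n := by simpa using hk
    rw [Nat.add_sub_cancel, Nat.choose_symm hk.le, Nat.sub_sub_self hk.le,
      cayley_of_pos (show 1 ≤ n - k by omega)]
    have : ((n - k : ℕ) : ℝ) ^ (n - k) = (n - k : ℕ) * ((n - k : ℕ) : ℝ) ^ (n - k - 1) := by
      rw [← pow_succ', show n - k - 1 + 1 = n - k by omega]
    rw [this]
    ring
  have h3 : (n : ℝ) ^ n = n * cayley n := by
    rw [cayley_of_pos hn, ← pow_succ', Nat.sub_add_cancel hn]
  simp only [Nat.add_sub_cancel] at h2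
  rw [Finset.sum_congr rfl h2]
  simp at h1 ⊢
  linarith

theorem numRooted_zero : numRooted 0 = 0 := rootedSeq_zero _

/-- Both sequences obey the same recursion. It determines the value at `n ≥ 2` because the extreme
terms `k = 0` and `k = n` vanish and `n - 1 ≠ 0`. -/
theorem numRooted_eq_cayley (n : ℕ) : numRooted n = cayley n := by
  induction n using Nat.strong_induction_on with
  | _ n ih =>
    rcases Nat.lt_or_ge n 2 with hn | hn
    · interval_cases n
      · rw [numRooted_zero, cayley_zero]
      · rw [numRooted_one]; simp [cayley]
    · have h1 := numRooted_recursion n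
      have h2 := sum_choose_mul_cayley_mul_cayley (n := n) (by omega)
      have h3 : ((n : ℝ) - 1) * numRooted n = ((n : ℝ) - 1) * cayley n := by
        rw [h1, ← h2]
        refine Finset.sum_congr rfl fun k hk => ?_
        have hk : k ≤ n := by simpa [Nat.lt_succ_iff] using hk
        rcases Nat.eq_zero_or_pos k with rfl | hk0
        · simp
        rcases hk.eq_or_lt with rfl | hkn
        · simp [numRooted_zero, cayley_zero]
        · rw [ih k hkn, ih (n - k) (by omega)]
      have h4 : (n : ℝ) - 1 ≠ 0 := by
        have : (2 : ℝ) ≤ n := by exact_mod_cast hn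
        linarith
      exact mul_left_cancel₀ h4 h3

end CayleyFormula

/-! ### Generating functions and the closed form for the cover numbers. -/

section GeneratingFunctions

open PowerSeries

/-- The exponential generating function of a sequence. -/
noncomputable def egf (a : ℕ → ℝ) : ℝ⟦X⟧ := PowerSeries.mk fun n => a n / n.factorial

/-- The derivation `x d/dx` on power series. -/
noncomputable def euler : Derivation ℝ ℝ⟦X⟧ ℝ⟦X⟧ := (X : ℝ⟦X⟧) • PowerSeries.derivative ℝ

theorem coeff_egf (a : ℕ → ℝ) (n : ℕ) : coeff n (egf a) = a n / n.factorial := coeff_mk _ _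

theorem coeff_euler (f : ℝ⟦X⟧) (n : ℕ) : coeff n (euler f) = n * coeff n f := by
  rw [euler, Derivation.smul_apply, smul_eq_mul]
  cases n with
  | zero => simp
  | succ n =>
    rw [coeff_succ_X_mul, coeff_derivative, mul_comm]
    push_cast
    rfl

theorem euler_mul (f g : ℝ⟦X⟧) : euler (f * g) = euler f * g + f * euler g := by
  rw [Derivation.leibniz, smul_eq_mul, smul_eq_mul]
  ring

theorem coeff_egf_mul_egf (a b : ℕ → ℝ) (n : ℕ) : coeff n (egf a * egf b) =
    (∑ k ∈ Finset.range (n + 1), (n.choose k : ℝ) * (a k * b (n - k))) / n.factorial := by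
  rw [coeff_mul, Finset.Nat.sum_antidiagonal_eq_sum_range_succ_mk, Finset.sum_div]
  refine Finset.sum_congr rfl fun k hk => ?_
  have hk : k ≤ n := by simpa [Nat.lt_succ_iff] using hk
  rw [coeff_egf, coeff_egf, Nat.cast_choose ℝ hk]
  field_simp

theorem euler_egf (a : ℕ → ℝ) : euler (egf a) = egf fun n => n * a n := by
  ext n
  rw [coeff_euler, coeff_egf, coeff_egf, mul_div_assoc]

theorem eq_of_euler_eq {f g : ℝ⟦X⟧} (h : euler f = euler g) (h0 : coeff 0 f = coeff 0 g) :
    f = g := by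
  ext n
  rcases Nat.eq_zero_or_pos n with rfl | hn
  · exact h0
  · have := congrArg (coeff n) h
    rw [coeff_euler, coeff_euler] at this
    exact mul_left_cancel₀ (by positivity) this

theorem euler_numRooted :
    euler (egf numRooted) = egf numRooted + euler (egf numRooted) * egf numRooted := by
  ext n
  rw [map_add, euler_egf, coeff_egf_mul_egf, coeff_egf, coeff_egf, ← add_div]
  congr 1
  have := numRooted_recursion n
  simp only [← mul_assoc] at *
  linarith

theorem euler_numUncovered :
    euler (egf numUncovered) = egf numUncovered + euler (egf numCovered) * egf numUncovered := by
  ext n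
  rw [map_add, euler_egf, euler_egf, coeff_egf_mul_egf, coeff_egf, coeff_egf, ← add_div]
  congr 1
  have := numUncovered_recursion n
  simp only [← mul_assoc] at *
  linarith

theorem euler_sumTau : euler (egf sumTau) = egf sumTau + euler (egf sumTau) * egf numRooted +
    euler (egf numRooted) * egf sumTau + euler (egf numUncovered) * egf numUncovered := by
  ext n
  simp only [map_add, euler_egf, coeff_egf_mul_egf, coeff_egf, ← add_div]
  congr 1
  have := sumTau_recursion n
  simp only [mul_add, Finset.sum_add_distrib] at this
  simp only [← mul_assoc] at *
  linarith

theorem egf_add (a b : ℕ → ℝ) : egf a + egf b = egf fun n => a n + b n := by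
  ext n
  simp [coeff_egf, add_div]

theorem egf_numCovered_add : egf numCovered + egf numUncovered = egf numRooted := by
  rw [egf_add]
  simp only [numCovered_add_numUncovered]

theorem one_sub_mul_one_add_euler :
    (1 - egf numRooted) * (1 + euler (egf numRooted)) = 1 := by
  linear_combination euler_numRooted

/-- The coefficient of order `n` reads `(n - 1) fₙ =` a combination of earlier ones. The factor
vanishes at `n = 1`, so `f₁` has to be prescribed as well as `f₀`. -/
theorem eq_zero_of_euler_eq_mul {N f : ℝ⟦X⟧} (hN : coeff 0 N = 1) (h : euler f = N * f)
    (h0 : coeff 0 f = 0) (h1 : coeff 1 f = 0) : f = 0 := by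
  ext n
  rw [map_zero]
  induction n using Nat.strong_induction_on with
  | _ n ih =>
    rcases Nat.lt_or_ge n 2 with hn | hn
    · interval_cases n
      exacts [h0, h1]
    · have h2 := congrArg (coeff n) h
      rw [coeff_euler, coeff_mul, Finset.Nat.sum_antidiagonal_eq_sum_range_succ_mk,
        Finset.sum_range_succ', Finset.sum_eq_zero, zero_add] at h2
      · simp only [Nat.sub_zero, hN, one_mul] at h2
        have h3 : (2 : ℝ) ≤ n := by exact_mod_cast hn
        have h4 : ((n : ℝ) - 1) * coeff n f = 0 := by linarith
        exact (mul_eq_zero.1 h4).resolve_left (by linarith)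
      · intro k hk
        have hk : k < n := by simpa using hk
        simp only
        rw [ih (n - (k + 1)) (by omega), mul_zero]

/-- The antiderivative `U` of `V` under `θ` counts unrooted trees weighted by `tau`. It is
identified as `T1 - T0²/2`: covered vertices, less the edges whose two halves both have uncovered
roots. Applying `θ` then gives `V`. -/
theorem egf_sumTau : egf sumTau = egf numCovered * (1 + euler (egf numRooted)) := by
  set T := egf numRooted with hT
  set T0 := egf numUncovered with hT0
  set T1 := egf numCovered with hT1
  set V := egf sumTau with hV
  have hsum : T1 + T0 = T := egf_numCovered_add
  have hDsum : euler T1 + euler T0 = euler T := by rw [← map_add, hsum]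
  have eT : euler T = T + euler T * T := euler_numRooted
  have eT0 : euler T0 = T0 + euler T1 * T0 := euler_numUncovered
  have eV : euler V = V + euler V * T + euler T * V + euler T0 * T0 := euler_sumTau
  have hinv : (1 - T) * (1 + euler T) = 1 := one_sub_mul_one_add_euler
  set U : ℝ⟦X⟧ := egf fun n => sumTau n / n with hU
  have hDU : euler U = V := by
    rw [hU, euler_egf, hV]
    congr 1
    ext n
    rcases Nat.eq_zero_or_pos n with rfl | hn
    · simp [sumTau, rootedSeq_zero]
    · field_simp
  have h0 : ∀ φ, coeff 0 (egf (rootedSeq φ)) = 0 := fun φ => by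
    rw [coeff_egf, rootedSeq_zero, zero_div]
  have hT00 : constantCoeff T0 = 0 := by
    rw [← coeff_zero_eq_constantCoeff_apply]; exact h0 _
  have hT10 : constantCoeff T1 = 0 := by
    rw [← coeff_zero_eq_constantCoeff_apply]; exact h0 _
  have hV0 : constantCoeff V = 0 := by
    rw [← coeff_zero_eq_constantCoeff_apply]; exact h0 _
  have hU0 : constantCoeff U = 0 := by
    rw [← coeff_zero_eq_constantCoeff_apply, hU, coeff_egf]; simp
  have hDTc : constantCoeff (euler T) = 0 := by
    rw [← coeff_zero_eq_constantCoeff_apply, coeff_euler]; simp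
  -- The equation for `V` integrated once: both sides have the same image under `θ` and zero
  -- constant term.
  have key : 2 * (V * (1 - T)) - 2 * U = T0 * T0 := by
    apply eq_of_euler_eq
    · have e2 : euler (2 : ℝ⟦X⟧) = 0 := by
        exact_mod_cast euler.map_natCast 2
      have e1 : euler (1 : ℝ⟦X⟧) = 0 := euler.map_one_eq_zero
      rw [map_sub, euler_mul, euler_mul, euler_mul, euler_mul, map_sub, e1, e2, hDU]
      linear_combination 2 * eV
    · simp [hV0, hU0, hT00]
  set W := 2 * T1 - T0 * T0 with hW
  have e2 : euler (2 : ℝ⟦X⟧) = 0 := by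
    exact_mod_cast euler.map_natCast 2
  have hDW : euler W = 2 * (euler T1 - T0 * euler T0) := by
    rw [hW, map_sub, euler_mul, euler_mul, e2]
    ring
  have hDW' : euler W * (1 - T) = 2 * T1 := by
    rw [hDW]
    linear_combination 2 * (1 - T) * (1 - T0) * hDsum - 2 * (1 - T) * eT0 + 2 * eT -
      2 * T0 * hinv - 2 * hsum
  -- `2U` and `W` both solve `(1 - T) θY - Y = T0²`. Since `(1 - T)⁻¹ = 1 + θT`, their difference
  -- satisfies `θZ = (1 + θT) Z` and has no terms of order 0 or 1.
  have hZ : 2 * U - W = 0 := by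
    refine eq_zero_of_euler_eq_mul (N := 1 + euler T) (by simp [hDTc]) ?_ ?_ ?_
    · rw [map_sub, euler_mul, e2, hDU]
      linear_combination (1 + euler T) * key - (1 + euler T) * hDW' - (2 * V - euler W) * hinv +
        (1 + euler T) * hW
    · simp [hW, hU0, hT00, hT10]
    · have hU1 : coeff 1 U = 0 := by rw [hU, coeff_egf]; simp [sumTau_one]
      have hT1' : coeff 1 T1 = 0 := by rw [hT1, coeff_egf]; simp [numCovered_one]
      have hT0' : coeff 1 (T0 * T0) = 0 := by
        simp [coeff_mul, Finset.Nat.antidiagonal_succ, hT00]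
      rw [hW, two_mul, two_mul, map_sub, map_sub, map_add, map_add, hU1, hT1', hT0']
      simp
  have : 2 * V = 2 * (T1 * (1 + euler T)) := by
    have h1 : 2 * V = euler W := by
      rw [← sub_eq_zero.1 hZ, euler_mul, e2, hDU]; ring
    rw [h1]
    linear_combination (1 + euler T) * hDW' - euler W * hinv
  ext n
  have h2 := congrArg (coeff n) this
  rw [two_mul, two_mul, map_add, map_add] at h2
  linarith

/-- The total of the vertex cover numbers, through the branches hanging from each vertex. -/
theorem sumTau_eq (n : ℕ) : sumTau n = ∑ k ∈ Finset.range (n + 1),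
    (n.choose k : ℝ) * (numCovered k * ((n - k : ℕ) : ℝ) ^ (n - k)) := by
  have h1 : 1 + euler (egf numRooted) = egf fun n => (n : ℝ) ^ n := by
    ext n
    rw [euler_egf, map_add, coeff_egf, coeff_egf, numRooted_eq_cayley]
    rcases Nat.eq_zero_or_pos n with rfl | hn
    · simp
    · rw [cayley_of_pos hn, ← pow_succ', Nat.sub_add_cancel hn, coeff_one, if_neg hn.ne', zero_add]
  have h2 := congrArg (coeff n) egf_sumTau
  rw [h1, coeff_egf_mul_egf, coeff_egf] at h2
  have h3 : (n.factorial : ℝ) ≠ 0 := by positivity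
  exact (div_left_inj' h3).1 h2

end GeneratingFunctions

/-! ### Nonnegative power series up to the endpoint of convergence. -/

section PowerSeriesCalculus

variable {c : ℕ → ℝ} {ρ : ℝ}

theorem continuousOn_tsum_mul_pow (hc : ∀ n, 0 ≤ c n) (hs : Summable fun n => c n * ρ ^ n) :
    ContinuousOn (fun x => ∑' n, c n * x ^ n) (Set.Icc 0 ρ) := by
  refine continuousOn_tsum (fun n => by fun_prop) hs fun n x hx => ?_
  rw [Real.norm_of_nonneg (mul_nonneg (hc n) (pow_nonneg hx.1 n))]
  exact mul_le_mul_of_nonneg_left (pow_le_pow_left₀ hx.1 hx.2 n) (hc n)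

theorem summable_mul_pow_of_le (hc : ∀ n, 0 ≤ c n) (hs : Summable fun n => c n * ρ ^ n) {x : ℝ}
    (hx0 : 0 ≤ x) (hx : x ≤ ρ) : Summable fun n => c n * x ^ n :=
  hs.of_nonneg_of_le (fun n => mul_nonneg (hc n) (pow_nonneg hx0 n)) fun n =>
    mul_le_mul_of_nonneg_left (pow_le_pow_left₀ hx0 hx n) (hc n)

theorem summable_deriv_mul_pow (hc : ∀ n, 0 ≤ c n) (hs : Summable fun n => c n * ρ ^ n) {r : ℝ}
    (hr0 : 0 < r) (hr : r < ρ) : Summable fun n => c n * (n * r ^ (n - 1)) := by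
  have hρ : 0 < ρ := hr0.trans hr
  obtain ⟨K, hK⟩ := (tendsto_self_mul_const_pow_of_lt_one (r := r / ρ) (by positivity)
    ((div_lt_one hρ).2 hr)).bddAbove_range
  refine (hs.mul_left (K / r)).of_nonneg_of_le
    (fun n => mul_nonneg (hc n) (by positivity)) fun n => ?_
  have h1 : (n : ℝ) * (r / ρ) ^ n ≤ K := hK ⟨n, rfl⟩
  have h2 : (n : ℝ) * r ^ n ≤ K * ρ ^ n := by
    rwa [div_pow, ← mul_div_assoc, div_le_iff₀ (by positivity)] at h1
  have h3 : (n : ℝ) * r ^ (n - 1) ≤ K / r * ρ ^ n := by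
    rw [div_mul_eq_mul_div, le_div_iff₀ hr0]
    refine le_trans (le_of_eq ?_) h2
    rcases Nat.eq_zero_or_pos n with rfl | hn
    · simp
    · rw [mul_assoc, ← pow_succ, Nat.sub_add_cancel hn]
  calc c n * (n * r ^ (n - 1)) ≤ c n * (K / r * ρ ^ n) := mul_le_mul_of_nonneg_left h3 (hc n)
    _ = K / r * (c n * ρ ^ n) := by ring

theorem hasDerivAt_tsum_mul_pow (hc : ∀ n, 0 ≤ c n) (hs : Summable fun n => c n * ρ ^ n) {x : ℝ}
    (hx : x ∈ Set.Ioo 0 ρ) :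
    HasDerivAt (fun x => ∑' n, c n * x ^ n) (∑' n, c n * (n * x ^ (n - 1))) x := by
  obtain ⟨r, hxr, hr⟩ := exists_between hx.2
  have hr0 : 0 < r := hx.1.trans hxr
  refine hasDerivAt_tsum_of_isPreconnected (t := Set.Ioo 0 r) (y₀ := x)
    (summable_deriv_mul_pow hc hs hr0 hr) isOpen_Ioo isPreconnected_Ioo
    (fun n y _ => (hasDerivAt_pow n y).const_mul (c n)) (fun n y hy => ?_) ⟨hx.1, hxr⟩
    (summable_mul_pow_of_le hc hs hx.1.le hx.2.le) ⟨hx.1, hxr⟩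
  have hy0 : 0 ≤ y := hy.1.le
  rw [Real.norm_of_nonneg (mul_nonneg (hc n) (by positivity))]
  have := pow_le_pow_left₀ hy0 hy.2.le (n - 1)
  exact mul_le_mul_of_nonneg_left (mul_le_mul_of_nonneg_left this (by positivity)) (hc n)

/-- The power series solution of `a' = b' a` is `a = a₀ exp b`. -/
theorem tsum_eq_mul_exp_tsum {a b : ℕ → ℝ} (ha : ∀ n, 0 ≤ a n) (hb : ∀ n, 0 ≤ b n) (hb0 : b 0 = 0)
    (hρ : 0 < ρ) (hsa : Summable fun n => a n * ρ ^ n) (hsb : Summable fun n => b n * ρ ^ n)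
    (hrec : ∀ m : ℕ, ((m : ℝ) + 1) * a (m + 1) =
      ∑ i ∈ Finset.range (m + 1), ((i : ℝ) + 1) * b (i + 1) * a (m - i)) :
    ∑' n, a n * ρ ^ n = a 0 * Real.exp (∑' n, b n * ρ ^ n) := by
  set A : ℝ → ℝ := fun x => ∑' n, a n * x ^ n with hA
  set B : ℝ → ℝ := fun x => ∑' n, b n * x ^ n with hB
  have hshift : ∀ {c : ℕ → ℝ} {x : ℝ}, (∀ n, 0 ≤ c n) → (Summable fun n => c n * ρ ^ n) →
      x ∈ Set.Ioo 0 ρ → Summable (fun n : ℕ => ((n : ℝ) + 1) * c (n + 1) * x ^ n) ∧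
      ∑' n, c n * (n * x ^ (n - 1)) = ∑' n : ℕ, ((n : ℝ) + 1) * c (n + 1) * x ^ n := by
    intro c x hc hs hx
    have h1 := summable_deriv_mul_pow hc hs hx.1 hx.2
    have h2 : (fun n : ℕ => ((n : ℝ) + 1) * c (n + 1) * x ^ n) =
        fun n => c (n + 1) * (((n + 1 : ℕ) : ℝ) * x ^ (n + 1 - 1)) := by
      funext n
      push_cast
      ring
    rw [h2]
    refine ⟨(summable_nat_add_iff 1).2 h1, ?_⟩
    rw [h1.tsum_eq_zero_add]
    simp
  have hderiv : ∀ x ∈ Set.Ioo 0 ρ, HasDerivAt (fun x => A x * Real.exp (-B x)) 0 x := by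
    intro x hx
    have h1 := hasDerivAt_tsum_mul_pow ha hsa hx
    have h2 := hasDerivAt_tsum_mul_pow hb hsb hx
    obtain ⟨hsa', ha'⟩ := hshift ha hsa hx
    obtain ⟨hsb', hb'⟩ := hshift hb hsb hx
    have hx0 : 0 ≤ x := hx.1.le
    have hprod : ∑' n, a n * (n * x ^ (n - 1)) = (∑' n, b n * (n * x ^ (n - 1))) * A x := by
      rw [ha', hb', hA]
      rw [tsum_mul_tsum_eq_tsum_sum_range_of_summable_norm hsb'.norm
        (summable_mul_pow_of_le ha hsa hx.1.le hx.2.le).norm]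
      refine tsum_congr fun m => ?_
      rw [hrec, Finset.sum_mul]
      refine Finset.sum_congr rfl fun i hi => ?_
      have hi : i ≤ m := by simpa [Nat.lt_succ_iff] using hi
      obtain ⟨j, rfl⟩ := Nat.exists_eq_add_of_le hi
      rw [Nat.add_sub_cancel_left, pow_add]
      ring
    refine (h1.mul h2.neg.exp).congr_deriv ?_
    rw [hprod]
    ring
  have hcont : ContinuousOn (fun x => A x * Real.exp (-B x)) (Set.Icc 0 ρ) :=
    (continuousOn_tsum_mul_pow ha hsa).mul (continuousOn_tsum_mul_pow hb hsb).neg.rexp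
  -- `A exp(-B)` has zero derivative only inside the interval; continuity up to `ρ` lets the mean
  -- value theorem compare the values at `0` and at `ρ` itself.
  obtain ⟨ξ, -, hξ⟩ := exists_hasDerivAt_eq_slope _ (fun _ => 0) hρ hcont hderiv
  have h0 : ∀ c : ℕ → ℝ, ∑' n, c n * (0 : ℝ) ^ n = c 0 := by
    intro c
    rw [tsum_eq_single 0 fun n hn => by simp [hn]]
    simp
  have h3 : A ρ * Real.exp (-B ρ) = A 0 * Real.exp (-B 0) := by
    have := (div_eq_zero_iff.1 hξ.symm).resolve_right (by linarith)
    linarith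
  have h4 : A 0 = a 0 := h0 a
  have h5 : B 0 = 0 := (h0 b).trans hb0
  rw [h4, h5, neg_zero, Real.exp_zero, mul_one, Real.exp_neg] at h3
  have h6 : Real.exp (B ρ) ≠ 0 := (Real.exp_pos _).ne'
  change A ρ = a 0 * Real.exp (B ρ)
  rw [← h3]
  field_simp

end PowerSeriesCalculus

/-! ### Values at `1/e` and the limit of the average. -/

section Limit

/-- Dividing `P` by `x` removes the linear term of `θP = P + θQ·P` and leaves `a' = Q' a` for `a = P
/ x`; hence the shifted indices. -/
theorem egf_recursion {p q : ℕ → ℝ} (hp0 : p 0 = 0)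
    (h : euler (egf p) = egf p + euler (egf q) * egf p) (m : ℕ) :
    ((m : ℝ) + 1) * (p (m + 1 + 1) / (m + 1 + 1).factorial) =
      ∑ i ∈ Finset.range (m + 1), ((i : ℝ) + 1) * (q (i + 1) / (i + 1).factorial) *
        (p (m - i + 1) / (m - i + 1).factorial) := by
  have h1 := congrArg (PowerSeries.coeff (m + 2)) h
  rw [map_add, PowerSeries.coeff_mul, Finset.Nat.sum_antidiagonal_eq_sum_range_succ_mk,
    Finset.sum_range_succ', Finset.sum_range_succ] at h1
  simp only [coeff_euler, coeff_egf, Nat.cast_zero, zero_mul, add_zero, Nat.sub_self, hp0,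
    zero_div, mul_zero] at h1
  have h2 : ∀ i ∈ Finset.range (m + 1), ((i : ℝ) + 1) * (q (i + 1) / (i + 1).factorial) *
      (p (m - i + 1) / (m - i + 1).factorial) = ((i + 1 : ℕ) : ℝ) *
      (q (i + 1) / (i + 1).factorial) * (p (m + 2 - (i + 1)) / (m + 2 - (i + 1)).factorial) := by
    intro i hi
    have hi : i ≤ m := by simpa [Nat.lt_succ_iff] using hi
    rw [show m + 2 - (i + 1) = m - i + 1 by omega]
    push_cast
    rfl
  rw [Finset.sum_congr rfl h2]
  push_cast at h1 ⊢
  simp only [add_assoc, one_add_one_eq_two] at h1 ⊢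
  linarith

/-- The value at `x = 1 / e` of the exponential generating function of `s`. -/
noncomputable def egfSum (s : ℕ → ℝ) : ℝ := ∑' n, s n / n.factorial * Real.exp (-1) ^ n

theorem egfSum_eq {p q : ℕ → ℝ} (hp : ∀ n, 0 ≤ p n) (hq : ∀ n, 0 ≤ q n) (hp0 : p 0 = 0)
    (hp1 : p 1 = 1) (hq0 : q 0 = 0)
    (hsp : Summable fun n : ℕ => p n / n.factorial * Real.exp (-1) ^ n)
    (hsq : Summable fun n : ℕ => q n / n.factorial * Real.exp (-1) ^ n)
    (h : euler (egf p) = egf p + euler (egf q) * egf p) :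
    egfSum p = Real.exp (egfSum q - 1) := by
  have hρ := Real.exp_pos (-1)
  have h1 := hsp.tsum_eq_zero_add
  have h2 : ∀ n : ℕ, p (n + 1) / (n + 1).factorial * Real.exp (-1) ^ (n + 1) =
      Real.exp (-1) * (p (n + 1) / (n + 1).factorial * Real.exp (-1) ^ n) := fun n => by ring
  have hs' : Summable fun n : ℕ => p (n + 1) / (n + 1).factorial * Real.exp (-1) ^ n := by
    have := (summable_nat_add_iff 1).2 hsp
    simp only [h2] at this
    exact (summable_mul_left_iff hρ.ne').1 this
  have h3 := tsum_eq_mul_exp_tsum (a := fun n => p (n + 1) / (n + 1).factorial)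
    (b := fun n => q n / n.factorial) (fun n => div_nonneg (hp _) (by positivity))
    (fun n => div_nonneg (hq _) (by positivity)) (by simp [hq0]) hρ hs' hsq
    (egf_recursion hp0 h)
  rw [egfSum, h1]
  simp only [h2, tsum_mul_left, h3, hp0, hp1]
  rw [sub_eq_add_neg, Real.exp_add, egfSum]
  simp [mul_comm]

/-- The probability weight of a branch of size `k` among `n` vertices. -/
noncomputable def branchWeight (n k : ℕ) : ℝ :=
  (n.choose k : ℝ) * ((n - k : ℕ) : ℝ) ^ (n - k) / (n : ℝ) ^ n

theorem branchWeight_nonneg (n k : ℕ) : 0 ≤ branchWeight n k := by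
  unfold branchWeight; positivity

/-- For `k > 0`, `kᵏ` times the weight is the binomial probability of `k` successes in `n` trials of
probability `k / n`, so the limit is Poisson's. -/
theorem tendsto_branchWeight (k : ℕ) :
    Tendsto (fun n => branchWeight n k) atTop (𝓝 (Real.exp (-1) ^ k / k.factorial)) := by
  rcases Nat.eq_zero_or_pos k with rfl | hk
  · refine tendsto_const_nhds.congr' ?_
    filter_upwards [eventually_ge_atTop 1] with n hn
    have : (n : ℝ) ^ n ≠ 0 := by positivity
    simp [branchWeight, this]
  have hkk : (k : ℝ) ^ k ≠ 0 := by positivity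
  have h1 : Tendsto (fun n : ℕ => (n : ℝ) * ((k : ℝ) / n)) atTop (𝓝 k) := by
    refine tendsto_const_nhds.congr' ?_
    filter_upwards [eventually_ge_atTop 1] with n hn
    have : (n : ℝ) ≠ 0 := by positivity
    field_simp
  have h2 := (ProbabilityTheory.tendsto_choose_mul_pow_of_tendsto_mul_atTop k h1).div_const
    ((k : ℝ) ^ k)
  have h3 : Real.exp (-(k : ℝ)) * (k : ℝ) ^ k / k.factorial / (k : ℝ) ^ k =
      Real.exp (-1) ^ k / k.factorial := by
    rw [← Real.exp_nat_mul, mul_neg_one]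
    field_simp
  rw [h3] at h2
  refine h2.congr' ?_
  filter_upwards [eventually_ge_atTop (k + 1)] with n hn
  have hn0 : (n : ℝ) ≠ 0 := by
    have : 0 < n := by omega
    positivity
  obtain ⟨m, rfl⟩ := Nat.exists_eq_add_of_le (show k ≤ n by omega)
  have h4 : 1 - (k : ℝ) / ((k + m : ℕ) : ℝ) = (m : ℝ) / ((k + m : ℕ) : ℝ) := by
    rw [eq_div_iff hn0, sub_mul, div_mul_cancel₀ _ hn0]
    push_cast
    ring
  rw [branchWeight, h4, Nat.add_sub_cancel_left, div_pow, div_pow, pow_add]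
  field_simp

theorem sum_cayley_mul_branchWeight {n : ℕ} (hn : 1 ≤ n) :
    ∑ k ∈ Finset.range (n + 1), cayley k * branchWeight n k = 1 := by
  have h1 : (n : ℝ) ^ n ≠ 0 := by positivity
  have h2 := sum_choose_mul_cayley_mul_pow hn
  rw [← div_self h1]
  nth_rw 1 [← h2]
  rw [Finset.sum_div]
  refine Finset.sum_congr rfl fun k _ => ?_
  rw [branchWeight]
  ring

theorem cayley_nonneg (n : ℕ) : 0 ≤ cayley n := by
  unfold cayley
  split_ifs <;> positivity

theorem sum_range_le_sum_branchWeight {s : ℕ → ℝ} (hs : ∀ n, 0 ≤ s n) (K n : ℕ) (h : K ≤ n + 1) :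
    ∑ k ∈ Finset.range K, s k * branchWeight n k ≤
      ∑ k ∈ Finset.range (n + 1), s k * branchWeight n k :=
  Finset.sum_le_sum_of_subset_of_nonneg (Finset.range_mono h)
    fun _ _ _ => mul_nonneg (hs _) (branchWeight_nonneg _ _)

theorem tendsto_sum_range_branchWeight (s : ℕ → ℝ) (K : ℕ) :
    Tendsto (fun n => ∑ k ∈ Finset.range K, s k * branchWeight n k) atTop
      (𝓝 (∑ k ∈ Finset.range K, s k / k.factorial * Real.exp (-1) ^ k)) := by
  refine tendsto_finsetSum _ fun k _ => ?_
  have := (tendsto_branchWeight k).const_mul (s k)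
  rwa [← mul_div_assoc, mul_div_right_comm] at this

theorem summable_cayley :
    Summable fun n : ℕ => cayley n / n.factorial * Real.exp (-1) ^ n := by
  refine summable_of_sum_range_le (c := 1) (fun n => ?_) fun K => ?_
  · have := cayley_nonneg n
    positivity
  · refine le_of_tendsto (tendsto_sum_range_branchWeight cayley K) ?_
    filter_upwards [eventually_ge_atTop (K + 1)] with n hn
    rw [← sum_cayley_mul_branchWeight (show 1 ≤ n by omega)]
    exact sum_range_le_sum_branchWeight cayley_nonneg K n (by omega)

/-- Fatou's lemma for these sums: a finite partial sum already exceeds `a`, and it converges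
termwise. -/
theorem eventually_lt_sum_branchWeight {s : ℕ → ℝ} (hs : ∀ n, 0 ≤ s n)
    (hsum : Summable fun n : ℕ => s n / n.factorial * Real.exp (-1) ^ n) {a : ℝ}
    (ha : a < egfSum s) :
    ∀ᶠ n in atTop, a < ∑ k ∈ Finset.range (n + 1), s k * branchWeight n k := by
  obtain ⟨K, hK⟩ := (hsum.hasSum.tendsto_sum_nat.eventually (lt_mem_nhds ha)).exists
  filter_upwards [(tendsto_sum_range_branchWeight s K).eventually (lt_mem_nhds hK),
    eventually_ge_atTop K] with n hn hnK
  exact hn.trans_le (sum_range_le_sum_branchWeight hs K n (by omega))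

theorem summable_of_le_cayley {s : ℕ → ℝ} (hs : ∀ n, 0 ≤ s n) (hle : ∀ n, s n ≤ cayley n) :
    Summable fun n : ℕ => s n / n.factorial * Real.exp (-1) ^ n := by
  refine summable_cayley.of_nonneg_of_le (fun n => ?_) fun n => ?_
  · have := hs n
    positivity
  · have := hle n
    gcongr

theorem numCovered_le (n : ℕ) : numCovered n ≤ cayley n := by
  rw [← numRooted_eq_cayley, ← numCovered_add_numUncovered]
  linarith [numUncovered_nonneg n]

theorem numUncovered_le (n : ℕ) : numUncovered n ≤ cayley n := by
  rw [← numRooted_eq_cayley, ← numCovered_add_numUncovered]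
  linarith [numCovered_nonneg n]

/-- The value satisfies `t = exp (t - 1)`, and `exp` meets its tangent at `0` only there. -/
theorem egfSum_cayley : egfSum cayley = 1 := by
  have hfun : numRooted = cayley := funext numRooted_eq_cayley
  have h := egfSum_eq cayley_nonneg cayley_nonneg cayley_zero (by simp [cayley]) cayley_zero
    summable_cayley summable_cayley (hfun ▸ euler_numRooted)
  by_contra hne
  have := Real.add_one_lt_exp (sub_ne_zero.2 hne)
  rw [← h] at this
  linarith

theorem egfSum_numCovered_add : egfSum numCovered + egfSum numUncovered = 1 := by
  rw [← egfSum_cayley, egfSum, egfSum, egfSum,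
    ← (summable_of_le_cayley numCovered_nonneg numCovered_le).tsum_add
      (summable_of_le_cayley numUncovered_nonneg numUncovered_le)]
  refine tsum_congr fun n => ?_
  rw [← numRooted_eq_cayley, ← numCovered_add_numUncovered]
  ring

theorem egfSum_numUncovered_mul_exp :
    egfSum numUncovered * Real.exp (egfSum numUncovered) = 1 := by
  have h := egfSum_eq numUncovered_nonneg numCovered_nonneg (rootedSeq_zero _) numUncovered_one
    (rootedSeq_zero _) (summable_of_le_cayley numUncovered_nonneg numUncovered_le)
    (summable_of_le_cayley numCovered_nonneg numCovered_le) euler_numUncovered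
  have h1 : egfSum numCovered - 1 = -egfSum numUncovered := by
    linarith [egfSum_numCovered_add]
  rw [h1] at h
  nth_rw 1 [h]
  rw [← Real.exp_add, neg_add_cancel, Real.exp_zero]

/-- Fatou gives the lower bound. The upper bound is Fatou for the uncovered counts, since the two
sums add up to exactly 1 and so do their proposed limits. -/
theorem tendsto_sumTau_div :
    Tendsto (fun n : ℕ => sumTau n / (n : ℝ) ^ n) atTop (𝓝 (egfSum numCovered)) := by
  have h1 : ∀ n : ℕ, sumTau n / (n : ℝ) ^ n =
      ∑ k ∈ Finset.range (n + 1), numCovered k * branchWeight n k := by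
    intro n
    rw [sumTau_eq, Finset.sum_div]
    refine Finset.sum_congr rfl fun k _ => ?_
    rw [branchWeight]
    ring
  simp only [h1]
  refine tendsto_order.2 ⟨fun a ha => eventually_lt_sum_branchWeight numCovered_nonneg
    (summable_of_le_cayley numCovered_nonneg numCovered_le) ha, fun a ha => ?_⟩
  have ha' : 1 - a < egfSum numUncovered := by linarith [egfSum_numCovered_add]
  filter_upwards [eventually_lt_sum_branchWeight numUncovered_nonneg
    (summable_of_le_cayley numUncovered_nonneg numUncovered_le) ha', eventually_ge_atTop 1]
    with n hn hn1
  have h2 := sum_cayley_mul_branchWeight hn1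
  simp only [← numRooted_eq_cayley, ← numCovered_add_numUncovered, add_mul,
    Finset.sum_add_distrib] at h2
  linarith

end Limit

/-! ### From rooted back to unrooted trees, and the numerical value. -/

theorem sum_labeledTrees (n : ℕ) (F : SimpleGraph (Fin n) → ℝ) :
    ∑ A ∈ labeledTrees n, F A = ∑ A : LTree (Fin n), F A.1 := by
  classical
  refine Finset.sum_subtype _ (fun A => ?_) F
  simp [labeledTrees]

theorem card_labeledTrees_mul (n : ℕ) : (n : ℝ) * ((labeledTrees n).card : ℝ) = cayley n := by
  have h := sum_labeledTrees n fun _ => (1 : ℝ)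
  rw [← numRooted_eq_cayley, numRooted, rootedSeq, rootedSum]
  simp only [unitWeight, Finset.sum_const, Finset.card_univ, Fintype.card_fin, nsmul_eq_mul,
    mul_one] at h ⊢
  rw [h, mul_comm]

theorem mul_sum_tau (n : ℕ) : (n : ℝ) * ∑ A ∈ labeledTrees n, (tau A : ℝ) = sumTau n := by
  rw [sum_labeledTrees n fun A => (tau A : ℝ), sumTau, rootedSeq, rootedSum, Finset.mul_sum]
  simp [tauWeight]

theorem avgCoverFraction_eq {n : ℕ} (hn : 1 ≤ n) :
    avgCoverFraction n = (∑ A ∈ labeledTrees n, (tau A : ℝ)) * (n : ℝ) ^ (1 - (n : ℤ)) := by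
  have hn0 : (n : ℝ) ≠ 0 := by positivity
  have h1 := card_labeledTrees_mul n
  rw [cayley_of_pos hn] at h1
  have h2 : (n : ℝ) ^ (1 - (n : ℤ)) = ((n : ℝ) ^ (n - 1))⁻¹ := by
    rw [← zpow_natCast, ← zpow_neg]
    congr 1
    omega
  rw [avgCoverFraction, ← Finset.sum_div, h2, ← h1, div_div, div_eq_mul_inv]
  rfl

theorem avgCoverFraction_eq_sumTau_div {n : ℕ} (hn : 1 ≤ n) :
    avgCoverFraction n = sumTau n / (n : ℝ) ^ n := by
  have hn0 : (n : ℝ) ≠ 0 := by positivity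
  rw [avgCoverFraction_eq hn, ← mul_sum_tau, zpow_sub₀ hn0, zpow_one, zpow_natCast]
  ring

theorem tau_eq_half (V : Type*) [Finite V] {A : SimpleGraph V} (hA : A.IsTree) :
    (tau A : ℝ) = (numBrown A : ℝ) + (numRed A : ℝ) / 2 := by
  have h : (2 : ℝ) * tau A = 2 * numBrown A + numRed A := by
    exact_mod_cast tau_eq_numBrown_add_numRed hA.isBipartite
  linarith

theorem mul_exp_strictMono {x y : ℝ} (hx : 0 ≤ x) (h : x < y) :
    x * Real.exp x < y * Real.exp y :=
  mul_lt_mul h (Real.exp_le_exp.2 h.le) (Real.exp_pos _) (hx.trans h.le)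

/-- `x exp x` increases for `x ≥ 0`, so `ω` is located by its values at two decimals, estimated with
15 Taylor terms of `exp`. -/
theorem omega_bounds {ω : ℝ} (h : ω * Real.exp ω = 1) :
    0.4328567095 ≤ 1 - ω ∧ 1 - ω < 0.4328567096 := by
  constructor
  · by_contra! hlt
    have h1 : (0.5671432905 : ℝ) < ω := by linarith
    have h2 := mul_exp_strictMono (by norm_num) h1
    have h3 := Real.exp_bound (x := 0.5671432905) (by norm_num [abs_of_pos]) (n := 15) (by norm_num)
    rw [abs_le] at h3
    norm_num [Finset.sum_range_succ, Nat.factorial, abs_of_pos] at h3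
    linarith [h3.1]
  · by_contra! hlt
    have h1 : ω ≤ (0.5671432904 : ℝ) := by linarith
    have h0 : 0 ≤ ω := by
      by_contra! hneg
      linarith [mul_neg_of_neg_of_pos hneg (Real.exp_pos ω)]
    have h2 : ω * Real.exp ω ≤ 0.5671432904 * Real.exp 0.5671432904 :=
      mul_le_mul h1 (Real.exp_le_exp.2 h1) (Real.exp_pos _).le (by norm_num)
    have h3 := Real.exp_bound (x := 0.5671432904) (by norm_num [abs_of_pos]) (n := 15) (by norm_num)
    rw [abs_le] at h3
    norm_num [Finset.sum_range_succ, Nat.factorial, abs_of_pos] at h3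
    linarith [h3.2]

end TreeColoring

theorem corollary1 :
    (∀ (V : Type*) [Finite V] (A : SimpleGraph V), A.IsTree →
      (∀ C : Set V, TreeColoring.IsMinVertexCover A C →
        (C.ncard : ℝ) =
          (TreeColoring.numBrown A : ℝ) + (TreeColoring.numRed A : ℝ) / 2) ∧
      (∀ M : A.Subgraph, TreeColoring.IsMaxMatching A M →
        (M.edgeSet.ncard : ℝ) =
          (TreeColoring.numBrown A : ℝ) + (TreeColoring.numRed A : ℝ) / 2)) ∧
    (∀ n : ℕ, 1 ≤ n →
      TreeColoring.avgCoverFraction n =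
        (n : ℝ) ^ (1 - (n : ℤ)) *
          ((TreeColoring.totalBrown n : ℝ) + (TreeColoring.totalRed n : ℝ) / 2)) ∧
    (∃ ω : ℝ, ω * Real.exp ω = 1 ∧
      0.4328567095 ≤ 1 - ω ∧ 1 - ω < 0.4328567096 ∧
      Tendsto TreeColoring.avgCoverFraction atTop (𝓝 (1 - ω))) := by
  open TreeColoring in
  refine ⟨fun V _ A hA => ⟨fun C hC => ?_, fun M hM => ?_⟩, fun n hn => ?_,
    egfSum numUncovered, egfSum_numUncovered_mul_exp,
    (omega_bounds egfSum_numUncovered_mul_exp).1, (omega_bounds egfSum_numUncovered_mul_exp).2, ?_⟩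
  · rw [(isMinVertexCover_iff.1 hC).2, tau_eq_half V hA]
  · rw [ncard_edgeSet_eq_tau hA.isBipartite hM, tau_eq_half V hA]
  · rw [avgCoverFraction_eq hn, mul_comm, totalBrown, totalRed]
    push_cast
    rw [Finset.sum_div, ← Finset.sum_add_distrib]
    congr 1
    refine Finset.sum_congr rfl fun A hA => tau_eq_half _ ?_
    simpa [labeledTrees] using hA
  · have h : 1 - egfSum numUncovered = egfSum numCovered := by
      linarith [egfSum_numCovered_add]
    rw [h]
    refine tendsto_sumTau_div.congr' ?_
    filter_upwards [eventually_ge_atTop 1] with n hn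
    exact (avgCoverFraction_eq_sumTau_div hn).symm
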